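/- Let $k$ be an algebraically closed field and let $H=(H_d)_{d\in\mathbb N}$ be a sequence of non-negative integers with $H_d=0$ for $d\gg0$. The Iarrobino variety $\mathbb H_{hom,H}$ is the set of homogeneous ideals $I=\bigoplus_d I_d\subset k[x,y]$ of colength $\sum_d H_d$ with $\operatorname{codim}(I_d,k[x,y]_d)=H_d$ for all $d$. It is embedded by $I\mapsto(I_d)_d$ in the product $\mathbb G$, over the $d$ with $H_d\neq0$, of the Grassmannians of subspaces of $k[x,y]_d$ of codimension $H_d$, and it carries the induced Zariski topology. Its Schubert cells are the nonempty intersections of $\mathbb H_{hom,H}$ with the products of the Schubert cells of these Grassmannians, taken with respect to the flags $F_i=\mathrm{Vect}(x^d,x^{d-1}y,\dots,x^{d-i+1}y^{i-1})$, $0\le i\le d+1$ (two subspaces lie in the same cell iff their intersections with every $F_i$ have the same dimension). For a monomial ideal $I$ put $E(I)=\{(a,b)\in\mathbb N^2 : x^ay^b\notin I\}$. A reverse plane partition with shape $E\subset\mathbb N^2$ is an array of integers $(n_{i,j})_{(i,j)\in E}$ with $n_{i,j}\le n_{i,j+1}$ and $n_{i,j}\le n_{i+1,j}$ whenever both indices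 are in $E$. A monomial ideal $I$ is linked to a monomial ideal $J$ by a reverse plane partition if there is a reverse plane partition $(n_{a,b})$ with shape $E(J)$ such that $E(I)=\{(a+n_{a,b},\,b-n_{a,b}) : (a,b)\in E(J)\}$. If $I$ is a monomial ideal of colength $n$, its complement $C(I)$ is the monomial ideal with $E(C(I))=\{(a,b) : a<n,\ b<n,\ x^{n-1-a}y^{n-1-b}\in I\}$. Theorem. Let $C$ and $C'$ be Schubert cells of $\mathbb H_{hom,H}$, let $I$ be a monomial ideal in $C$ and $I'$ a monomial ideal in $C'$. If $\overline C\cap C'\neq\emptyset$, then $I$ is linked to $I'$ by a reverse plane partition, and $C(I)$ is linked to $C(I')$ by a reverse plane partition. -/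

import Mathlib

namespace Iarrobino

open MvPolynomial

attribute [local instance] MvPolynomial.gradedAlgebra

/-- The polynomial ring `k[x, y]`, with `x = X 0` and `y = X 1`. -/
abbrev PolyRing (k : Type*) [Field k] : Type _ := MvPolynomial (Fin 2) k

/-- The space `k[x, y]_d` of forms of degree `d`. -/
abbrev Forms (k : Type*) [Field k] (d : ℕ) : Submodule k (PolyRing k) :=
  homogeneousSubmodule (Fin 2) k d

/-- The exponent vector of the monomial `x ^ a * y ^ b`. -/
noncomputable def expo (a b : ℕ) : Fin 2 →₀ ℕ := Finsupp.single 0 a + Finsupp.single 1 b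

/-- The monomial `x ^ a * y ^ b`. -/
noncomputable def mon (k : Type*) [Field k] (a b : ℕ) : PolyRing k := monomial (expo a b) 1

/-- The degree `d` part `I_d` of an ideal `I`, as a subspace of `k[x, y]_d`. -/
noncomputable def gradedPart {k : Type*} [Field k] (I : Ideal (PolyRing k)) (d : ℕ) :
    Submodule k (Forms k d) :=
  (I.restrictScalars k).comap (Forms k d).subtype

/-- The colength `dim k[x, y] / I` of an ideal. -/
noncomputable def colength {k : Type*} [Field k] (I : Ideal (PolyRing k)) : ℕ :=
  Module.finrank k (PolyRing k ⧸ I)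

/-- The Iarrobino variety: homogeneous ideals `I` of colength `∑ H_d` such that `I_d` has
codimension `H_d` in `k[x, y]_d` for every `d`. -/
def Variety (k : Type*) [Field k] (H : ℕ →₀ ℕ) : Type _ :=
  {I : Ideal (PolyRing k) // I.IsHomogeneous (homogeneousSubmodule (Fin 2) k) ∧
    colength I = H.sum (fun _ h => h) ∧
    ∀ d, Module.finrank k (Forms k d ⧸ gradedPart I d) = H d}

/-- The product of the Grassmannians of subspaces of codimension `H_d` of `k[x, y]_d`, over the
`d` with `H_d ≠ 0`. -/
def GrassProduct (k : Type*) [Field k] (H : ℕ →₀ ℕ) : Type _ :=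
  ∀ d : H.support, Module.Grassmannian k (Forms k d) (H d)

/-- The inclusion of the Iarrobino variety in the product of Grassmannians, `I ↦ (I_d)_d`. -/
noncomputable def toGrassProduct {k : Type*} [Field k] {H : ℕ →₀ ℕ} (I : Variety k H) :
    GrassProduct k H := fun d =>
  { toSubmodule := gradedPart I.1 d
    finite_quotient := Module.finite_of_finrank_pos
      ((I.2.2.2 d).symm ▸ Nat.pos_of_ne_zero (Finsupp.mem_support_iff.mp d.2))
    projective_quotient := inferInstance
    rankAtStalk_eq := fun p => by
      have : Module.Finite k (Forms k d ⧸ gradedPart I.1 d) := Module.finite_of_finrank_pos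
        ((I.2.2.2 d).symm ▸ Nat.pos_of_ne_zero (Finsupp.mem_support_iff.mp d.2))
      rw [Module.rankAtStalk_eq_finrank_of_free]
      exact I.2.2.2 d }

/-- `w` is a basis of the subspace `W`. -/
def IsFrame {k V : Type*} [Field k] [AddCommGroup V] [Module k V] {r : ℕ}
    (W : Submodule k V) (w : Fin r → V) : Prop :=
  LinearIndependent k w ∧ Submodule.span k (Set.range w) = W

/-- The indices of the Plücker coordinates on the product of Grassmannians: a degree `d` together
with an increasing choice of `d + 1 - H_d` of the `d + 1` monomials
`x ^ d, x ^ (d - 1) * y, …, y ^ d`. -/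
abbrev PlueckerIndex (H : ℕ →₀ ℕ) : Type :=
  Σ d : H.support, (Fin (d + 1 - H d) ↪o Fin (d + 1))

/-- The Plücker coordinates attached to a choice of a basis in every degree: the maximal minors
of the matrices of coefficients in the monomial bases. -/
noncomputable def plueckerCoord {k : Type*} [Field k] {H : ℕ →₀ ℕ}
    (w : ∀ d : H.support, Fin (d + 1 - H d) → Forms k d) (s : PlueckerIndex H) : k :=
  Matrix.det (Matrix.of fun i j =>
    coeff (expo (s.1 - (s.2 j : ℕ)) (s.2 j : ℕ)) (w s.1 i : PolyRing k))

/-- `f` is multihomogeneous of multidegree `e` in the Plücker coordinates: homogeneous of degree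
`e d` in the coordinates of the `d`-th Grassmannian, for every `d`. -/
def IsMultihomogeneous {k : Type*} [Field k] {H : ℕ →₀ ℕ}
    (f : MvPolynomial (PlueckerIndex H) k) (e : H.support → ℕ) : Prop :=
  IsWeightedHomogeneous (fun s : PlueckerIndex H => (Pi.single s.1 1 : H.support → ℕ)) f e

/-- The set of points of the product of Grassmannians at which `f` does not vanish. For `f`
multihomogeneous, this does not depend on the chosen bases. -/
def basicOpen {k : Type*} [Field k] {H : ℕ →₀ ℕ} (f : MvPolynomial (PlueckerIndex H) k) :
    Set (GrassProduct k H) :=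
  {W | ∃ w : ∀ d : H.support, Fin (d + 1 - H d) → Forms k d,
    (∀ d, IsFrame (W d).toSubmodule (w d)) ∧ eval (plueckerCoord w) f ≠ 0}

/-- The Zariski topology on the product of Grassmannians (a subvariety of a product of projective
spaces by the Plücker embeddings): the closed sets are the zero loci of families of
multihomogeneous polynomials in the Plücker coordinates. -/
noncomputable instance zariskiTopology (k : Type*) [Field k] (H : ℕ →₀ ℕ) :
    TopologicalSpace (GrassProduct k H) :=
  TopologicalSpace.generateFrom
    {U | ∃ (f : MvPolynomial (PlueckerIndex H) k) (e : H.support → ℕ),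
      IsMultihomogeneous f e ∧ U = basicOpen f}

/-- The Zariski topology on the Iarrobino variety. -/
noncomputable instance varietyTopology (k : Type*) [Field k] (H : ℕ →₀ ℕ) : TopologicalSpace (Variety k H) :=
  TopologicalSpace.induced toGrassProduct (zariskiTopology k H)

/-- The flag in `k[x, y]_d`: `F_i` is spanned by the first `i` of the monomials
`x ^ d, x ^ (d - 1) * y, …, y ^ d`. -/
noncomputable def flag (k : Type*) [Field k] (d i : ℕ) : Submodule k (Forms k d) :=
  (Submodule.span k {m : PolyRing k | ∃ j, j < i ∧ j ≤ d ∧ m = mon k (d - j) j}).comap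
    (Forms k d).subtype

/-- The Schubert cell, with respect to the flag above, with set of jumps `J`: the subspaces `W`
such that `dim (W ∩ F_i)` is the number of `j ∈ J` with `j < i` (jumps numbered from `0`). -/
def schubertCell (k : Type*) [Field k] (d c : ℕ) (J : Finset (Fin (d + 1))) :
    Set (Module.Grassmannian k (Forms k d) c) :=
  {W | ∀ i ≤ d + 1, Module.finrank k (W.toSubmodule ⊓ flag k d i : Submodule k (Forms k d)) =
    (J.filter (fun j : Fin (d + 1) => (j : ℕ) < i)).card}

/-- The Schubert cells of the Iarrobino variety: the nonempty restrictions of the products of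
Schubert cells. -/
def IsSchubertCell {k : Type*} [Field k] {H : ℕ →₀ ℕ} (C : Set (Variety k H)) : Prop :=
  C.Nonempty ∧ ∃ J : ∀ d : H.support, Finset (Fin (d + 1)),
    C = {I | ∀ d : H.support, toGrassProduct I d ∈ schubertCell k d (H d) (J d)}

/-- An ideal generated by monomials. -/
def IsMonomialIdeal {k : Type*} [Field k] (I : Ideal (PolyRing k)) : Prop :=
  ∃ S : Set (ℕ × ℕ), I = Ideal.span ((fun p => mon k p.1 p.2) '' S)

/-- The set `E(I)` of the monomials `x ^ a * y ^ b` that are not in `I`. -/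
def standardMonomials {k : Type*} [Field k] (I : Ideal (PolyRing k)) : Set (ℕ × ℕ) :=
  {p | mon k p.1 p.2 ∉ I}

/-- The array `n` (whose values outside `E` are irrelevant) is a reverse plane partition with
shape `E`. -/
def IsReversePlanePartition (E : Set (ℕ × ℕ)) (n : ℕ → ℕ → ℤ) : Prop :=
  (∀ i j, (i, j) ∈ E → (i, j + 1) ∈ E → n i j ≤ n i (j + 1)) ∧
  (∀ i j, (i, j) ∈ E → (i + 1, j) ∈ E → n i j ≤ n (i + 1) j)

/-- `I` is linked to `J` by a reverse plane partition `n` with shape `E(J)`: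
`E(I) = {x ^ (a + n a b) * y ^ (b - n a b) | (a, b) ∈ E(J)}`, the exponents being compared
in `ℤ`. -/
def IsLinked {k : Type*} [Field k] (I J : Ideal (PolyRing k)) : Prop :=
  ∃ n : ℕ → ℕ → ℤ, IsReversePlanePartition (standardMonomials J) n ∧
    (fun p : ℕ × ℕ => ((p.1 : ℤ), (p.2 : ℤ))) '' standardMonomials I =
      (fun p : ℕ × ℕ => ((p.1 : ℤ) + n p.1 p.2, (p.2 : ℤ) - n p.1 p.2)) '' standardMonomials J

/-- The exponents `(a, b)` with `a, b < n` and `x ^ (n - 1 - a) * y ^ (n - 1 - b) ∈ I`, where `n`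
is the colength of `I`. -/
def complementExponents {k : Type*} [Field k] (I : Ideal (PolyRing k)) : Set (ℕ × ℕ) :=
  {p | p.1 < colength I ∧ p.2 < colength I ∧
    mon k (colength I - 1 - p.1) (colength I - 1 - p.2) ∈ I}

/-- The complement `C(I)` of a monomial ideal `I`: the monomial ideal whose standard monomials are
the `complementExponents` of `I`. -/
noncomputable def complement {k : Type*} [Field k] (I : Ideal (PolyRing k)) : Ideal (PolyRing k) :=
  Ideal.span ((fun p : ℕ × ℕ => mon k p.1 p.2) '' (complementExponents I)ᶜ)

lemma expo_le_iff (a b c d : ℕ) : expo a b ≤ expo c d ↔ a ≤ c ∧ b ≤ d := by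
  constructor
  · intro h
    have h0 := h 0
    have h1 := h 1
    simpa [expo] using And.intro h0 h1
  · rintro ⟨h0, h1⟩
    exact add_le_add (Finsupp.single_le_single.mpr h0) (Finsupp.single_le_single.mpr h1)

lemma mon_mul (k : Type*) [Field k] (a b c d : ℕ) :
    mon k a b * mon k c d = mon k (a + c) (b + d) := by
  have h : expo a b + expo c d = expo (a + c) (b + d) := by
    simp only [expo, Finsupp.single_add]
    abel
  rw [mon, mon, mon, monomial_mul, mul_one, h]

lemma standardMonomials_complement {k : Type*} [Field k] (I : Ideal (PolyRing k)) :
    standardMonomials (complement I) = complementExponents I := by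
  ext ⟨a, b⟩
  have key : mon k a b ∈ complement I ↔
      ∃ p ∈ (complementExponents I)ᶜ, p.1 ≤ a ∧ p.2 ≤ b := by
    have h : (fun p : ℕ × ℕ => mon k p.1 p.2) '' (complementExponents I)ᶜ =
        (fun s => monomial s (1 : k)) '' ((fun p : ℕ × ℕ => expo p.1 p.2) ''
          (complementExponents I)ᶜ) := by
      rw [Set.image_image]; rfl
    rw [complement, h, mem_ideal_span_monomial_image]
    simp [mon, expo_le_iff]
  have hup : (∃ p ∈ (complementExponents I)ᶜ, p.1 ≤ a ∧ p.2 ≤ b) ↔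
      (a, b) ∉ complementExponents I := by
    constructor
    · rintro ⟨p, hp, ha, hb⟩ ⟨h1, h2, h3⟩
      refine hp ⟨lt_of_le_of_lt ha h1, lt_of_le_of_lt hb h2, ?_⟩
      have := I.mul_mem_left (mon k (a - p.1) (b - p.2)) h3
      rw [mon_mul] at this
      dsimp only at this h1 h2
      convert this using 2 <;> omega
    · intro h
      exact ⟨(a, b), h, le_rfl, le_rfl⟩
  show ¬ (mon k a b ∈ complement I) ↔ _
  rw [key, hup, not_not]

end Iarrobino

/-!
Let `K` be a point of the closure of `C` that lies in `C'`. Forms of degree `d` are written as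
polynomials of degree at most `d` in `z = y / x`, so that multiplication by `x` becomes an
inclusion, multiplication by `y` becomes multiplication by `z`, the flag `F_i` becomes the space of
polynomials of degree less than `i`, and the jumps of a subspace become the degrees of its elements.

*A generic ideal degenerating to `K`.* There is an ultrafilter `u` that contains `C` and converges
to `K`. The ultraproduct of the ideals along `u` has degree `d` parts `W d` (`limitSlice`) over the
field `L` of germs of functions along `u`, and the degrees of `W d` are those of the ideals in `C`
(`degrees_limitSlice`). Because `u` converges to `K` in the Zariski topology, the germs of the
rational functions defined at `K` form a ring in which those vanishing at `K` form a proper ideal,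
and a valuation ring of `L` dominates it (`exists_valuation`). By Cramer's rule, each element of
`K` is the reduction of an element of the ultraproduct, and a dimension count shows that the
reduction of `W d` has the degrees of the degree `d` part of `K` (`leads_limitSlice`).

*The links.* For a subspace `U` of `L[z]`, let `leads v U` be the set of the degrees of the elements
of its reduction; it has as many elements as the dimension of `U` (`ncard_leads`). Consider the
increasing sequences `W d + F_i` and `W d ∩ F_i`, `0 ≤ i ≤ d + 1`. At each step where the subspace
grows, so does the set of its leads (`image_entryStep`). The first sequence grows at the `i` that
are not degrees of `W d`, the second at the degrees of `W d`. Sending a lead `b` to the step at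
which it enters thus maps the exponents of `y` in the degree `d` monomials of `E(I')`, respectively
of `I'`, onto those in `E(I)`, respectively `I`. As `x` maps the `i`-th space in degree `d` into the
`i`-th one in degree `d + 1`, and `y` maps it into the `(i + 1)`-st one, the entry steps satisfy
exactly the inequalities of a reverse plane partition. The first sequence gives the link from `I`
to `I'`, and the second one, after the rotation `(a, b) ↦ (n - 1 - a, n - 1 - b)`, the link of the
complements.
-/

namespace Iarrobino
open Polynomial

/-! ### Leading positions with respect to a valuation -/

section Leads

variable {L Γ : Type*} [Field L] [LinearOrderedCommGroupWithZero Γ] (v : Valuation L Γ)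

/-- `j` is the leading position of `p` with respect to `v`: the largest index of a coefficient of
maximal valuation. If `p` is scaled to have coefficients in the valuation ring, not all in the
maximal ideal, this is the degree of the reduction of `p`. -/
def IsLead (p : L[X]) (j : ℕ) : Prop :=
  (∀ c, v (p.coeff c) ≤ v (p.coeff j)) ∧ ∀ c, j < c → v (p.coeff c) < v (p.coeff j)

/-- The leading positions of the elements of `U`, that is, the degrees of the elements of the
reduction of `U`. -/
def leads (U : Submodule L L[X]) : Set ℕ := {j | ∃ p ∈ U, IsLead v p j}

variable {v}

lemma IsLead.coeff_ne_zero {p : L[X]} {j : ℕ} (h : IsLead v p j) : p.coeff j ≠ 0 := by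
  intro h0
  have := h.2 (j + 1) (Nat.lt_succ_self j)
  simp [h0] at this

lemma IsLead.X_mul {p : L[X]} {j : ℕ} (h : IsLead v p j) : IsLead v (X * p) (j + 1) := by
  refine ⟨fun c => ?_, fun c hc => ?_⟩
  · cases c with
    | zero => simp
    | succ c => simpa using h.1 c
  · cases c with
    | zero => omega
    | succ c => simpa using h.2 c (by omega)

lemma exists_isLead {p : L[X]} (hp : p ≠ 0) : ∃ j, IsLead v p j := by
  classical
  obtain ⟨m, hm, hmax⟩ := p.support.exists_max_image (fun c => v (p.coeff c))
    (support_nonempty.mpr hp)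
  obtain ⟨j, hj, hjmax⟩ := (p.support.filter fun c => v (p.coeff c) = v (p.coeff m)).exists_max_image
    id ⟨m, by simpa using mem_support_iff.mp hm⟩
  rw [Finset.mem_filter] at hj
  have hle : ∀ c, v (p.coeff c) ≤ v (p.coeff j) := by
    intro c
    by_cases hc : p.coeff c = 0
    · simp [hc]
    · rw [hj.2]; exact hmax c (mem_support_iff.mpr hc)
  refine ⟨j, hle, fun c hc => lt_of_le_of_ne (hle c) fun h => ?_⟩
  have hc0 : p.coeff c ≠ 0 := by
    intro h0
    rw [h0, map_zero, eq_comm, map_eq_zero] at h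
    exact mem_support_iff.mp hj.1 h
  have := hjmax c (Finset.mem_filter.mpr ⟨mem_support_iff.mpr hc0, h.trans hj.2⟩)
  simp only [id] at this
  omega

/-- Polynomials with distinct leading positions are linearly independent, since their reductions
have distinct degrees. -/
lemma linearIndependent_of_isLead {ι : Type*} {e : ι → ℕ} (he : Function.Injective e)
    {p : ι → L[X]} (hp : ∀ i, IsLead v (p i) (e i)) : LinearIndependent L p := by
  classical
  rw [linearIndependent_iff']
  intro s c hsum i hi
  by_contra hci
  -- among the terms of maximal valuation at their own position, take the one placed highest
  obtain ⟨m, hm, hmax⟩ := s.exists_max_image (fun i => v (c i * (p i).coeff (e i))) ⟨i, hi⟩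
  obtain ⟨j, hj, hjmax⟩ := (s.filter fun i => v (c i * (p i).coeff (e i)) =
    v (c m * (p m).coeff (e m))).exists_max_image e ⟨m, by simpa using hm⟩
  rw [Finset.mem_filter] at hj
  have hj0 : v (c j * (p j).coeff (e j)) ≠ 0 := by
    have h1 : v (c i * (p i).coeff (e i)) ≠ 0 :=
      (Valuation.ne_zero_iff v).mpr (mul_ne_zero hci (hp i).coeff_ne_zero)
    have h2 := hmax i hi
    rw [← hj.2] at h2
    intro h
    rw [h] at h2
    exact h1 (le_zero_iff.mp h2)
  have hcoeff : ∑ l ∈ s, c l * (p l).coeff (e j) = 0 := by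
    have := congrArg (fun q : L[X] => q.coeff (e j)) hsum
    simpa [finsetSum_coeff] using this
  rw [← Finset.add_sum_erase s _ hj.1, add_eq_zero_iff_eq_neg] at hcoeff
  -- every other term has strictly smaller valuation at the position `e j`
  have hlt : v (∑ l ∈ s.erase j, c l * (p l).coeff (e j)) < v (c j * (p j).coeff (e j)) := by
    refine Valuation.map_sum_lt v hj0 fun l hl => ?_
    obtain ⟨hlj, hls⟩ := Finset.mem_erase.mp hl
    have hle : v (c l * (p l).coeff (e l)) ≤ v (c j * (p j).coeff (e j)) := by
      rw [hj.2]; exact hmax l hls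
    rcases lt_trichotomy (e l) (e j) with h | h | h
    · by_cases hcl : c l = 0
      · simpa [hcl] using zero_lt_iff.mpr hj0
      · refine lt_of_lt_of_le ?_ hle
        rw [map_mul, map_mul]
        exact mul_lt_mul_of_pos_left ((hp l).2 _ h)
          (zero_lt_iff.mpr ((Valuation.ne_zero_iff v).mpr hcl))
    · exact absurd (he h) hlj
    · have hne : v (c l * (p l).coeff (e l)) < v (c j * (p j).coeff (e j)) := by
        refine lt_of_le_of_ne hle fun heq => ?_
        have := hjmax l (Finset.mem_filter.mpr ⟨hls, heq.trans hj.2⟩)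
        omega
      refine lt_of_le_of_lt ?_ hne
      rw [map_mul, map_mul]
      exact mul_le_mul_right ((hp l).1 _) _
  rw [hcoeff, Valuation.map_neg] at hlt
  exact lt_irrefl _ hlt

variable (v)

lemma leads_mono {U U' : Submodule L L[X]} (h : U ≤ U') : leads v U ⊆ leads v U' :=
  fun _ ⟨p, hp, hj⟩ => ⟨p, h hp, hj⟩

lemma finite_leads (U : Submodule L L[X]) [FiniteDimensional L U] : (leads v U).Finite := by
  choose p hp hl using fun j : leads v U => j.2
  have hli : LinearIndependent L (fun j : leads v U => (⟨p j, hp j⟩ : U)) :=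
    LinearIndependent.of_comp U.subtype
      (linearIndependent_of_isLead Subtype.val_injective hl)
  have := hli.finite
  exact Set.toFinite _

/-- Reduction preserves dimensions: there are as many leading positions as the dimension. -/
lemma ncard_leads (U : Submodule L L[X]) [FiniteDimensional L U] :
    (leads v U).ncard = Module.finrank L U := by
  have hfin := finite_leads v U
  have := hfin.fintype
  rw [← Nat.card_coe_set_eq, Nat.card_eq_fintype_card]
  apply le_antisymm
  · choose p hp hl using fun j : leads v U => j.2
    have hli : LinearIndependent L (fun j : leads v U => (⟨p j, hp j⟩ : U)) :=
      LinearIndependent.of_comp U.subtype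
        (linearIndependent_of_isLead Subtype.val_injective hl)
    exact hli.fintype_card_le_finrank
  · -- an element of `U` is determined by its coefficients at the leading positions
    let φ : U →ₗ[L] (leads v U → L) :=
      LinearMap.pi fun j => (lcoeff L (j : ℕ)).comp U.subtype
    have hφ : Function.Injective φ := by
      rw [← LinearMap.ker_eq_bot, LinearMap.ker_eq_bot']
      rintro ⟨p, hp⟩ h0
      by_contra hne
      obtain ⟨j, hj⟩ := exists_isLead (v := v) (p := p) (fun h => hne (Subtype.ext h))
      have := congrFun h0 ⟨j, p, hp, hj⟩
      exact hj.coeff_ne_zero this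
    simpa using LinearMap.finrank_le_finrank_of_injective hφ

lemma exists_mem_leads_of_lt {U U' : Submodule L L[X]} [FiniteDimensional L U']
    (h : U < U') : ∃ b ∈ leads v U', b ∉ leads v U := by
  have : FiniteDimensional L U := Submodule.finiteDimensional_of_le h.le
  by_contra! hcon
  have h1 : leads v U' = leads v U := Set.Subset.antisymm hcon (leads_mono v h.le)
  have h2 := Submodule.finrank_lt_finrank_of_lt h
  rw [← ncard_leads v U, ← ncard_leads v U', h1] at h2
  exact lt_irrefl _ h2

lemma mem_leads_degreeLT {i b : ℕ} : b ∈ leads v (degreeLT L i) ↔ b < i := by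
  constructor
  · rintro ⟨p, hp, hb⟩
    by_contra h
    exact hb.coeff_ne_zero (coeff_eq_zero_of_degree_lt
      ((mem_degreeLT.mp hp).trans_le (by exact_mod_cast not_lt.mp h)))
  · intro h
    refine ⟨X ^ b, mem_degreeLT.mpr (by simpa using h), fun c => ?_, fun c hc => ?_⟩
    · simp only [coeff_X_pow]; split_ifs <;> simp
    · simp [coeff_X_pow, hc.ne']

end Leads

/-- The degrees of the nonzero elements of a space of polynomials. -/
def degrees {F : Type*} [Field F] (U : Submodule F F[X]) : Set ℕ :=
  {j | ∃ p ∈ U, p ≠ 0 ∧ p.natDegree = j}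

/-- Degrees are the leading positions for the trivial valuation. -/
lemma ncard_degrees {F : Type*} [Field F] (U : Submodule F F[X]) [FiniteDimensional F U] :
    (degrees U).ncard = Module.finrank F U := by
  classical
  rw [← ncard_leads (1 : Valuation F (WithZero (Multiplicative ℤ))) U]
  congr 1
  ext j
  refine exists_congr fun p => and_congr_right fun _ => ⟨?_, fun h => ?_⟩
  · rintro ⟨hp, rfl⟩
    have hl : p.coeff p.natDegree ≠ 0 := by simpa using hp
    refine ⟨fun c => ?_, fun c hc => ?_⟩
    · rw [Valuation.one_apply_of_ne_zero hl]
      exact Valuation.one_apply_le_one _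
    · rw [Valuation.one_apply_of_ne_zero hl, coeff_eq_zero_of_natDegree_lt hc]
      simp
  · have h0 := h.coeff_ne_zero
    refine ⟨fun hp => h0 (by simp [hp]), le_antisymm ?_ (le_natDegree_of_ne_zero h0)⟩
    rw [natDegree_le_iff_coeff_eq_zero]
    intro c hc
    by_contra hne
    have := h.2 c hc
    rw [Valuation.one_apply_of_ne_zero hne, Valuation.one_apply_of_ne_zero h0] at this
    exact lt_irrefl _ this

/-! ### Position functions of growing families of subspaces -/

section Growth

variable {L Γ : Type*} [Field L] [LinearOrderedCommGroupWithZero Γ] (v : Valuation L Γ)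

/-- The step at which `b` appears among the leading positions of an increasing sequence of
subspaces: the least `i` such that `b` is a leading position of `U (i + 1)`. -/
noncomputable def entryStep (U : ℕ → Submodule L L[X]) (b : ℕ) : ℕ :=
  sInf {i | b ∈ leads v (U (i + 1))}

variable {v}

lemma entryStep_le {U : ℕ → Submodule L L[X]} {b i : ℕ} (h : b ∈ leads v (U (i + 1))) :
    entryStep v U b ≤ i := Nat.sInf_le h

lemma mem_leads_entryStep {U : ℕ → Submodule L L[X]} {b i : ℕ} (h : b ∈ leads v (U (i + 1))) :
    b ∈ leads v (U (entryStep v U b + 1)) :=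
  Nat.sInf_mem (s := {i | b ∈ leads v (U (i + 1))}) ⟨i, h⟩

/-- The steps at which the positions between `U 0` and `U (d + 1)` enter are the steps at which
`U` grows. -/
lemma image_entryStep {U : ℕ → Submodule L L[X]} (hU : Monotone U)
    (hfin : ∀ i, FiniteDimensional L (U i)) (d : ℕ) :
    entryStep v U '' (leads v (U (d + 1)) \ leads v (U 0)) = {i | i ≤ d ∧ U i ≠ U (i + 1)} := by
  ext i
  constructor
  · rintro ⟨b, ⟨hb, hb0⟩, rfl⟩
    refine ⟨entryStep_le hb, fun h => ?_⟩
    have h1 := mem_leads_entryStep hb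
    rw [← h] at h1
    obtain h2 | ⟨i, hi⟩ : entryStep v U b = 0 ∨ ∃ i, entryStep v U b = i + 1 := by
      cases entryStep v U b <;> simp
    · rw [h2] at h1; exact hb0 h1
    · rw [hi] at h1
      have := entryStep_le h1
      omega
  · rintro ⟨hi, hne⟩
    obtain ⟨b, hb, hb'⟩ := exists_mem_leads_of_lt v (lt_of_le_of_ne (hU (Nat.le_succ i)) hne)
    refine ⟨b, ⟨leads_mono v (hU (by omega)) hb, fun h => hb' (leads_mono v (hU (Nat.zero_le i)) h)⟩,
      le_antisymm (entryStep_le hb) ?_⟩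
    by_contra hlt
    exact hb' (leads_mono v (hU (by omega)) (mem_leads_entryStep hb))

lemma entryStep_le_of_le {U U' : ℕ → Submodule L L[X]} (h : ∀ i, U i ≤ U' i) {b i : ℕ}
    (hb : b ∈ leads v (U (i + 1))) : entryStep v U' b ≤ entryStep v U b :=
  entryStep_le (leads_mono v (h _) (mem_leads_entryStep hb))

lemma entryStep_succ_le {U U' : ℕ → Submodule L L[X]}
    (h : ∀ i, ∀ p ∈ U i, X * p ∈ U' (i + 1)) {b i : ℕ}
    (hb : b ∈ leads v (U (i + 1))) : entryStep v U' (b + 1) ≤ entryStep v U b + 1 := by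
  obtain ⟨p, hp, hl⟩ := mem_leads_entryStep hb
  exact entryStep_le ⟨X * p, h _ p hp, hl.X_mul⟩

lemma inf_degreeLT_ne_iff (W : Submodule L L[X]) (i : ℕ) :
    W ⊓ degreeLT L i ≠ W ⊓ degreeLT L (i + 1) ↔ i ∈ degrees W := by
  have hle : W ⊓ degreeLT L i ≤ W ⊓ degreeLT L (i + 1) :=
    inf_le_inf_left _ (degreeLT_mono (Nat.le_succ i))
  rw [← not_iff_not, not_not, ← hle.ge_iff_eq]
  constructor
  · rintro h ⟨p, hp, hp0, rfl⟩
    have := (h ⟨hp, mem_degreeLT.mpr ((degree_eq_natDegree hp0).trans_lt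
      (by exact_mod_cast Nat.lt_succ_self _))⟩).2
    rw [SetLike.mem_coe, mem_degreeLT, degree_eq_natDegree hp0] at this
    exact lt_irrefl _ this
  · rintro h p ⟨hp, hpd⟩
    refine ⟨hp, mem_degreeLT.mpr ?_⟩
    by_cases hp0 : p = 0
    · simp [hp0]
    · rw [SetLike.mem_coe, mem_degreeLT, degree_eq_natDegree hp0] at hpd
      rw [degree_eq_natDegree hp0]
      have h1 : p.natDegree ≠ i := fun h' => h ⟨p, hp, hp0, h'⟩
      have h2 : p.natDegree < i + 1 := by exact_mod_cast hpd
      exact_mod_cast (by omega : p.natDegree < i)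

lemma sup_degreeLT_ne_iff (W : Submodule L L[X]) (i : ℕ) :
    W ⊔ degreeLT L i ≠ W ⊔ degreeLT L (i + 1) ↔ i ∉ degrees W := by
  have hle : W ⊔ degreeLT L i ≤ W ⊔ degreeLT L (i + 1) :=
    sup_le_sup_left (degreeLT_mono (Nat.le_succ i)) _
  have hX : (X ^ i : L[X]) ∈ degreeLT L (i + 1) := mem_degreeLT.mpr (by
    rw [degree_X_pow]; exact_mod_cast Nat.lt_succ_self i)
  rw [not_iff_not, ← hle.ge_iff_eq]
  constructor
  · intro h
    obtain ⟨w, hw, q, hq, hwq⟩ := Submodule.mem_sup.mp (h (Submodule.mem_sup_right hX))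
    have hd : w.degree = i := by
      rw [eq_sub_of_add_eq hwq, degree_sub_eq_left_of_degree_lt, degree_X_pow]
      rw [degree_X_pow]; exact mem_degreeLT.mp hq
    exact ⟨w, hw, fun h0 => by simp [h0] at hd, natDegree_eq_of_degree_eq_some hd⟩
  · rintro ⟨w, hw, hw0, rfl⟩
    refine sup_le le_sup_left fun p hp => ?_
    have hl : w.leadingCoeff ≠ 0 := by simpa using hw0
    -- subtract the multiple of `w` that kills the leading term
    rw [← sub_add_cancel p (C (p.coeff w.natDegree / w.leadingCoeff) * w), add_comm]
    refine Submodule.add_mem_sup (by rw [← smul_eq_C_mul]; exact W.smul_mem _ hw) ?_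
    rw [mem_degreeLT, degree_lt_iff_coeff_zero]
    intro m hm
    rcases hm.eq_or_lt with rfl | hm
    · simp [hl, coeff_natDegree]
    · rw [coeff_sub, coeff_C_mul, coeff_eq_zero_of_natDegree_lt hm,
        (degree_lt_iff_coeff_zero _ _).mp (mem_degreeLT.mp hp) m hm]
      simp

end Growth

/-! ### Dehomogenization -/

section Dehomogenization

variable {k : Type*} [Field k]

/-- The homogenization in degree `d` of a polynomial in `z = y / x`: it sends `z ^ j` to
`x ^ (d - j) * y ^ j` for `j ≤ d`. -/
noncomputable def homogenize (k : Type*) [Field k] (d : ℕ) : k[X] →ₗ[k] PolyRing k :=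
  ∑ j ∈ Finset.range (d + 1), (lcoeff k j).smulRight (mon k (d - j) j)

lemma homogenize_apply (d : ℕ) (p : k[X]) :
    homogenize k d p = ∑ j ∈ Finset.range (d + 1), p.coeff j • mon k (d - j) j := by
  simp [homogenize]

lemma expo_inj {a b c e : ℕ} : expo a b = expo c e ↔ a = c ∧ b = e := by
  rw [le_antisymm_iff, expo_le_iff, expo_le_iff]
  omega

lemma expo_eta (s : Fin 2 →₀ ℕ) : expo (s 0) (s 1) = s := by
  ext i
  fin_cases i <;> simp [expo]

lemma degree_expo (a b : ℕ) : (expo a b).degree = a + b := by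
  rw [expo, map_add, Finsupp.degree_single, Finsupp.degree_single]

lemma coeff_mon (a b c e : ℕ) :
    MvPolynomial.coeff (expo a b) (mon k c e) = if c = a ∧ e = b then 1 else 0 := by
  rw [mon, MvPolynomial.coeff_monomial]
  simp only [expo_inj]

lemma coeff_homogenize {d j : ℕ} (hj : j ≤ d) (p : k[X]) :
    MvPolynomial.coeff (expo (d - j) j) (homogenize k d p) = p.coeff j := by
  rw [homogenize_apply, MvPolynomial.coeff_sum, Finset.sum_eq_single j]
  · simp [coeff_mon]
  · intro i _ hij
    simp [coeff_mon, hij]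
  · intro h
    exact absurd (Finset.mem_range.mpr (by omega)) h

lemma mon_mem_forms {a b d : ℕ} (h : a + b = d) : mon k a b ∈ Forms k d := by
  rw [MvPolynomial.mem_homogeneousSubmodule]
  refine MvPolynomial.isHomogeneous_monomial _ ?_
  rw [degree_expo, h]

lemma homogenize_mem_forms (d : ℕ) (p : k[X]) : homogenize k d p ∈ Forms k d := by
  rw [homogenize_apply]
  refine Submodule.sum_mem _ fun j hj => Submodule.smul_mem _ _ (mon_mem_forms ?_)
  have := Finset.mem_range.mp hj
  omega

lemma exists_homogenize_eq {d : ℕ} {f : PolyRing k} (hf : f ∈ Forms k d) :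
    ∃ p ∈ degreeLT k (d + 1), homogenize k d p = f := by
  refine ⟨∑ j ∈ Finset.range (d + 1), monomial j (MvPolynomial.coeff (expo (d - j) j) f),
    Submodule.sum_mem _ fun j hj => ?_, ?_⟩
  · rw [mem_degreeLT]
    exact (degree_monomial_le _ _).trans_lt (by exact_mod_cast Finset.mem_range.mp hj)
  · ext s
    obtain ⟨a, b, rfl⟩ : ∃ a b, s = expo a b := ⟨s 0, s 1, (expo_eta s).symm⟩
    by_cases h : a + b = d
    · obtain rfl : a = d - b := by omega
      rw [coeff_homogenize (by omega), finsetSum_coeff, Finset.sum_eq_single b]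
      · simp
      · intro i _ hib
        simp [coeff_monomial, hib]
      · intro h
        exact absurd (Finset.mem_range.mpr (by omega)) h
    · have hdeg : (expo a b).degree ≠ d := by
        rwa [degree_expo]
      rw [((MvPolynomial.mem_homogeneousSubmodule _ _).mp (homogenize_mem_forms d _)).coeff_eq_zero
        hdeg, ((MvPolynomial.mem_homogeneousSubmodule _ _).mp hf).coeff_eq_zero hdeg]

/-- Polynomials of degree at most `d` are the dehomogenizations of the forms of degree `d`. -/
noncomputable def formsEquiv (k : Type*) [Field k] (d : ℕ) :
    degreeLT k (d + 1) ≃ₗ[k] Forms k d :=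
  LinearEquiv.ofBijective
    (((homogenize k d).comp (degreeLT k (d + 1)).subtype).codRestrict (Forms k d)
      fun p => homogenize_mem_forms d (p : k[X])) <| by
    constructor
    · rw [← LinearMap.ker_eq_bot, LinearMap.ker_eq_bot']
      rintro ⟨p, hp⟩ h0
      have h1 : homogenize k d p = 0 := congrArg Subtype.val h0
      ext j
      by_cases hj : j ≤ d
      · rw [← coeff_homogenize hj, h1]; simp
      · exact (degree_lt_iff_coeff_zero _ _).mp (mem_degreeLT.mp hp) j (by omega)
    · rintro ⟨f, hf⟩
      obtain ⟨p, hp, h⟩ := exists_homogenize_eq hf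
      exact ⟨⟨p, hp⟩, Subtype.ext h⟩

lemma coe_formsEquiv (d : ℕ) (p : degreeLT k (d + 1)) :
    (formsEquiv k d p : PolyRing k) = homogenize k d p := rfl

instance (d : ℕ) : FiniteDimensional k (degreeLT k d) :=
  (degreeLTEquiv k d).symm.finiteDimensional

instance (d : ℕ) : FiniteDimensional k (Forms k d) := (formsEquiv k d).finiteDimensional

lemma finrank_forms (d : ℕ) : Module.finrank k (Forms k d) = d + 1 := by
  rw [← (formsEquiv k d).finrank_eq, (degreeLTEquiv k (d + 1)).finrank_eq, Module.finrank_fin_fun]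

/-- The dehomogenization of a space of forms of degree `d`. -/
noncomputable def dehomogenize {d : ℕ} (W : Submodule k (Forms k d)) : Submodule k k[X] :=
  (W.comap (formsEquiv k d).toLinearMap).map (degreeLT k (d + 1)).subtype

lemma mem_dehomogenize {d : ℕ} {W : Submodule k (Forms k d)} {p : k[X]} :
    p ∈ dehomogenize W ↔ ∃ h : p ∈ degreeLT k (d + 1), formsEquiv k d ⟨p, h⟩ ∈ W := by
  simp [dehomogenize]

lemma dehomogenize_le {d : ℕ} (W : Submodule k (Forms k d)) :
    dehomogenize W ≤ degreeLT k (d + 1) := fun _ hp => (mem_dehomogenize.mp hp).1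

instance {d : ℕ} (W : Submodule k (Forms k d)) : FiniteDimensional k (dehomogenize W) :=
  Submodule.finiteDimensional_of_le (dehomogenize_le W)

lemma finrank_dehomogenize {d : ℕ} (W : Submodule k (Forms k d)) :
    Module.finrank k (dehomogenize W) = Module.finrank k W := by
  rw [dehomogenize,
    (Submodule.equivMapOfInjective _ (Submodule.injective_subtype _) _).symm.finrank_eq]
  exact LinearEquiv.finrank_eq ((formsEquiv k d).ofSubmodule' W)

lemma mem_flag {d i : ℕ} (p : degreeLT k (d + 1)) :
    formsEquiv k d p ∈ flag k d i ↔ (p : k[X]) ∈ degreeLT k i := by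
  rw [flag, Submodule.mem_comap, Submodule.subtype_apply, coe_formsEquiv]
  constructor
  · intro h
    rw [mem_degreeLT, degree_lt_iff_coeff_zero]
    intro j hj
    by_cases hjd : j ≤ d
    · rw [← coeff_homogenize hjd]
      refine (Submodule.span_le (p := LinearMap.ker
        (MvPolynomial.lcoeff k (expo (d - j) j)))).mpr ?_ h
      rintro _ ⟨l, hl, _, rfl⟩
      simp only [SetLike.mem_coe, LinearMap.mem_ker, MvPolynomial.lcoeff_apply, coeff_mon]
      rw [if_neg (by omega)]
    · exact (degree_lt_iff_coeff_zero _ _).mp (mem_degreeLT.mp p.2) j (by omega)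
  · intro h
    rw [homogenize_apply]
    refine Submodule.sum_mem _ fun j hj => ?_
    by_cases hji : j < i
    · exact Submodule.smul_mem _ _ (Submodule.subset_span
        ⟨j, hji, by have := Finset.mem_range.mp hj; omega, rfl⟩)
    · rw [(degree_lt_iff_coeff_zero _ _).mp (mem_degreeLT.mp h) j (by omega), zero_smul]
      exact Submodule.zero_mem _

lemma dehomogenize_inf_flag {d : ℕ} (W : Submodule k (Forms k d)) (i : ℕ) :
    dehomogenize (W ⊓ flag k d i) = dehomogenize W ⊓ degreeLT k i := by
  ext p
  simp only [Submodule.mem_inf, mem_dehomogenize]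
  constructor
  · rintro ⟨h, h1, h2⟩
    exact ⟨⟨h, h1⟩, (mem_flag ⟨p, h⟩).mp h2⟩
  · rintro ⟨⟨h, h1⟩, h2⟩
    exact ⟨h, h1, (mem_flag ⟨p, h⟩).mpr h2⟩

/-- The jumps of a point of a Schubert cell are the degrees of its dehomogenization. -/
lemma mem_degrees_of_mem_schubertCell {d c : ℕ} {J : Finset (Fin (d + 1))}
    {W : Module.Grassmannian k (Forms k d) c} (hW : W ∈ schubertCell k d c J) (j : ℕ) :
    j ∈ degrees (dehomogenize W.toSubmodule) ↔ ∃ h : j < d + 1, (⟨j, h⟩ : Fin (d + 1)) ∈ J := by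
  have hdim : ∀ i ≤ d + 1, Module.finrank k
      (dehomogenize W.toSubmodule ⊓ degreeLT k i : Submodule k k[X]) =
      (J.filter (fun j : Fin (d + 1) => (j : ℕ) < i)).card := fun i hi => by
    rw [← hW i hi, ← dehomogenize_inf_flag, finrank_dehomogenize]
  by_cases hj : j < d + 1
  · have hle : dehomogenize W.toSubmodule ⊓ degreeLT k j ≤
        dehomogenize W.toSubmodule ⊓ degreeLT k (j + 1) :=
      inf_le_inf_left _ (degreeLT_mono (Nat.le_succ j))
    have hsub : (J.filter fun l : Fin (d + 1) => (l : ℕ) < j) ⊆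
        J.filter fun l : Fin (d + 1) => (l : ℕ) < j + 1 := by
      intro l hl
      rw [Finset.mem_filter] at hl ⊢
      exact ⟨hl.1, by omega⟩
    rw [← inf_degreeLT_ne_iff, not_iff_comm, not_exists]
    constructor
    · intro h
      refine Submodule.eq_of_le_of_finrank_eq hle ?_
      rw [hdim _ (by omega), hdim _ (by omega)]
      refine congrArg Finset.card (Finset.Subset.antisymm hsub fun l hl => ?_)
      rw [Finset.mem_filter] at hl ⊢
      refine ⟨hl.1, lt_of_le_of_ne (by omega) ?_⟩
      rintro rfl
      exact h hj hl.1
    · intro h hj' hmem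
      have h1 := hdim j (by omega)
      rw [h, hdim _ (by omega)] at h1
      have h2 := Finset.eq_of_subset_of_card_le hsub h1.le
      have h3 : (⟨j, hj'⟩ : Fin (d + 1)) ∈ J.filter fun l : Fin (d + 1) => (l : ℕ) < j + 1 := by
        simp [hmem]
      rw [← h2] at h3
      simp at h3
  · refine iff_of_false ?_ fun ⟨h, _⟩ => hj h
    rintro ⟨p, hp, hp0, rfl⟩
    have := mem_degreeLT.mp (dehomogenize_le _ hp)
    rw [degree_eq_natDegree hp0] at this
    exact hj (by exact_mod_cast this)

end Dehomogenization

/-! ### The dehomogenized graded parts of an ideal -/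

section Slice

variable {k : Type*} [Field k]

/-- The dehomogenization of the degree `d` part of an ideal. -/
noncomputable def slice (I : Ideal (PolyRing k)) (d : ℕ) : Submodule k k[X] :=
  dehomogenize (gradedPart I d)

lemma mem_slice {I : Ideal (PolyRing k)} {d : ℕ} {p : k[X]} :
    p ∈ slice I d ↔ p ∈ degreeLT k (d + 1) ∧ homogenize k d p ∈ I := by
  rw [slice, mem_dehomogenize]
  exact ⟨fun ⟨h, hp⟩ => ⟨h, hp⟩, fun ⟨h, hp⟩ => ⟨h, hp⟩⟩

lemma slice_le (I : Ideal (PolyRing k)) (d : ℕ) : slice I d ≤ degreeLT k (d + 1) :=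
  dehomogenize_le _

instance (I : Ideal (PolyRing k)) (d : ℕ) : FiniteDimensional k (slice I d) :=
  Submodule.finiteDimensional_of_le (slice_le I d)

lemma slice_le_succ (I : Ideal (PolyRing k)) (d : ℕ) : slice I d ≤ slice I (d + 1) := by
  intro p hp
  rw [mem_slice] at hp ⊢
  refine ⟨degreeLT_mono (Nat.le_succ _) hp.1, ?_⟩
  have : homogenize k (d + 1) p = mon k 1 0 * homogenize k d p := by
    rw [homogenize_apply, homogenize_apply, Finset.sum_range_succ,
      (degree_lt_iff_coeff_zero _ _).mp (mem_degreeLT.mp hp.1) (d + 1) le_rfl, zero_smul, add_zero,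
      Finset.mul_sum]
    refine Finset.sum_congr rfl fun j hj => ?_
    have := Finset.mem_range.mp hj
    rw [mul_smul_comm, mon_mul, zero_add, show 1 + (d - j) = d + 1 - j by omega]
  rw [this]
  exact I.mul_mem_left _ hp.2

lemma X_mul_mem_slice {I : Ideal (PolyRing k)} {d : ℕ} {p : k[X]} (hp : p ∈ slice I d) :
    X * p ∈ slice I (d + 1) := by
  rw [mem_slice] at hp ⊢
  refine ⟨?_, ?_⟩
  · rw [mem_degreeLT, degree_lt_iff_coeff_zero]
    intro j hj
    obtain ⟨j, rfl⟩ : ∃ i, j = i + 1 := ⟨j - 1, by omega⟩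
    rw [coeff_X_mul]
    exact (degree_lt_iff_coeff_zero _ _).mp (mem_degreeLT.mp hp.1) j (by omega)
  · have : homogenize k (d + 1) (X * p) = mon k 0 1 * homogenize k d p := by
      rw [homogenize_apply, homogenize_apply, Finset.sum_range_succ', coeff_X_mul_zero, zero_smul,
        add_zero, Finset.mul_sum]
      refine Finset.sum_congr rfl fun j hj => ?_
      rw [mul_smul_comm, mon_mul, zero_add, coeff_X_mul, add_comm 1 j,
        show d + 1 - (j + 1) = d - j by omega]
    rw [this]
    exact I.mul_mem_left _ hp.2

lemma mem_slice_mon {I : Ideal (PolyRing k)} {d j : ℕ} (hj : j ≤ d) :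
    X ^ j ∈ slice I d ↔ mon k (d - j) j ∈ I := by
  have : homogenize k d (X ^ j) = mon k (d - j) j := by
    rw [homogenize_apply, Finset.sum_eq_single j]
    · simp
    · intro i _ hij
      simp [coeff_X_pow, hij]
    · intro h
      exact absurd (Finset.mem_range.mpr (by omega)) h
  rw [mem_slice, this, and_iff_right]
  rw [mem_degreeLT, degree_X_pow]
  exact_mod_cast Nat.lt_succ_of_le hj

lemma IsMonomialIdeal.mon_mem {I : Ideal (PolyRing k)} (hI : IsMonomialIdeal I) {f : PolyRing k}
    (hf : f ∈ I) {a b : ℕ} (hab : MvPolynomial.coeff (expo a b) f ≠ 0) : mon k a b ∈ I := by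
  obtain ⟨S, rfl⟩ := hI
  have h : (fun p : ℕ × ℕ => mon k p.1 p.2) '' S =
      (fun s => MvPolynomial.monomial s (1 : k)) '' ((fun p : ℕ × ℕ => expo p.1 p.2) '' S) := by
    rw [Set.image_image]; rfl
  rw [h, MvPolynomial.mem_ideal_span_monomial_image] at hf ⊢
  intro s hs
  obtain rfl := Finset.mem_singleton.mp (MvPolynomial.support_monomial_subset hs)
  exact hf _ (MvPolynomial.mem_support_iff.mpr hab)

lemma IsMonomialIdeal.mem_degrees_slice {I : Ideal (PolyRing k)} (hI : IsMonomialIdeal I)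
    {d j : ℕ} : j ∈ degrees (slice I d) ↔ j ≤ d ∧ mon k (d - j) j ∈ I := by
  constructor
  · rintro ⟨p, hp, hp0, rfl⟩
    have hd : p.natDegree ≤ d := by
      have := mem_degreeLT.mp (slice_le _ _ hp)
      rw [degree_eq_natDegree hp0] at this
      exact Nat.lt_succ_iff.mp (by exact_mod_cast this)
    refine ⟨hd, hI.mon_mem (mem_slice.mp hp).2 ?_⟩
    rw [coeff_homogenize hd]
    simpa using hp0
  · rintro ⟨hj, h⟩
    exact ⟨X ^ j, (mem_slice_mon hj).mpr h, by simp, by simp⟩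

variable {H : ℕ →₀ ℕ}

lemma finrank_gradedPart (I : Variety k H) (d : ℕ) :
    Module.finrank k (gradedPart I.1 d) + H d = d + 1 := by
  rw [← I.2.2.2 d, add_comm, Submodule.finrank_quotient_add_finrank, finrank_forms]

lemma finrank_slice (I : Variety k H) (d : ℕ) :
    Module.finrank k (slice I.1 d) = d + 1 - H d := by
  rw [slice, finrank_dehomogenize]
  have := finrank_gradedPart I d
  omega

lemma slice_eq_of_eq_zero (I : Variety k H) {d : ℕ} (hd : H d = 0) :
    slice I.1 d = degreeLT k (d + 1) := by
  refine Submodule.eq_of_le_of_finrank_eq (slice_le _ _) ?_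
  rw [finrank_slice, hd, (degreeLTEquiv k (d + 1)).finrank_eq, Module.finrank_fin_fun]
  rfl

/-- Points of the same Schubert cell have the same degrees. -/
lemma IsSchubertCell.degrees_slice_eq {C : Set (Variety k H)} (hC : IsSchubertCell C)
    {I K : Variety k H} (hI : I ∈ C) (hK : K ∈ C) (d : ℕ) :
    degrees (slice I.1 d) = degrees (slice K.1 d) := by
  obtain ⟨-, J, rfl⟩ := hC
  by_cases hd : H d = 0
  · rw [slice_eq_of_eq_zero I hd, slice_eq_of_eq_zero K hd]
  · ext j
    have hI' := mem_degrees_of_mem_schubertCell (hI ⟨d, Finsupp.mem_support_iff.mpr hd⟩) j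
    have hK' := mem_degrees_of_mem_schubertCell (hK ⟨d, Finsupp.mem_support_iff.mpr hd⟩) j
    exact hI'.trans hK'.symm

lemma apply_succ_eq_zero (I : Variety k H) {d : ℕ} (hd : H d = 0) : H (d + 1) = 0 := by
  have hall : degreeLT k (d + 1 + 1) ≤ slice I.1 (d + 1) := by
    intro p hp
    rw [mem_degreeLT, degree_lt_iff_coeff_zero] at hp
    rw [← X_mul_divX_add p]
    refine Submodule.add_mem _ (X_mul_mem_slice ?_) (slice_le_succ _ _ ?_) <;>
      rw [slice_eq_of_eq_zero I hd, mem_degreeLT, degree_lt_iff_coeff_zero]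
    · intro m hm
      rw [coeff_divX]
      exact hp _ (by omega)
    · intro m hm
      rw [coeff_C, if_neg (by omega)]
  have h1 := Submodule.finrank_mono hall
  rw [finrank_slice, (degreeLTEquiv k _).finrank_eq, Module.finrank_fin_fun] at h1
  omega

/-- The Hilbert function vanishes from the colength on. -/
lemma apply_eq_zero_of_sum_le (I : Variety k H) {d : ℕ} (hd : H.sum (fun _ h => h) ≤ d) :
    H d = 0 := by
  by_contra h0
  have hpos : ∀ e ≤ d, H e ≠ 0 := by
    intro e he hHe
    have hall : ∀ n, H (e + n) = 0 := fun n => by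
      induction n with
      | zero => exact hHe
      | succ n ih => exact apply_succ_eq_zero I ih
    exact h0 (Nat.add_sub_cancel' he ▸ hall (d - e))
  have hsub : Finset.range (d + 1) ⊆ H.support := fun e he =>
    Finsupp.mem_support_iff.mpr (hpos e (Nat.lt_succ_iff.mp (Finset.mem_range.mp he)))
  have h1 : ∑ e ∈ Finset.range (d + 1), 1 ≤ H.sum (fun _ h => h) := by
    refine le_trans (Finset.sum_le_sum fun e he => ?_) (Finset.sum_le_sum_of_subset hsub)
    exact Nat.one_le_iff_ne_zero.mpr (hpos e (Nat.lt_succ_iff.mp (Finset.mem_range.mp he)))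
  simp at h1
  omega

end Slice

/-! ### Plücker coordinates -/

section Pluecker

variable {k : Type*} [Field k]

/-- The coefficients of forms of degree `d` in the monomial basis. -/
noncomputable def coordEquiv (k : Type*) [Field k] (d : ℕ) : Forms k d ≃ₗ[k] (Fin (d + 1) → k) :=
  (formsEquiv k d).symm.trans (degreeLTEquiv k (d + 1))

lemma coordEquiv_formsEquiv {d : ℕ} (p : degreeLT k (d + 1)) (j : Fin (d + 1)) :
    coordEquiv k d (formsEquiv k d p) j = (p : k[X]).coeff j := by
  simp [coordEquiv, degreeLTEquiv]

lemma coordEquiv_apply {d : ℕ} (f : Forms k d) (j : Fin (d + 1)) :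
    coordEquiv k d f j = MvPolynomial.coeff (expo (d - j) j) (f : PolyRing k) := by
  obtain ⟨p, rfl⟩ := (formsEquiv k d).surjective f
  rw [coordEquiv_formsEquiv, coe_formsEquiv, coeff_homogenize (by omega)]

/-- The matrix of the coefficients of a family of forms. -/
noncomputable def coeffMatrix {d r : ℕ} (w : Fin r → Forms k d) : Matrix (Fin r) (Fin (d + 1)) k :=
  Matrix.of fun i => coordEquiv k d (w i)

lemma vecMul_coeffMatrix {d r : ℕ} (w : Fin r → Forms k d) (α : Fin r → k) :
    Matrix.vecMul α (coeffMatrix w) = coordEquiv k d (∑ i, α i • w i) := by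
  ext j
  simp [Matrix.vecMul, dotProduct, coeffMatrix, map_sum]

lemma exists_det_ne_zero {d r : ℕ} {w : Fin r → Forms k d} (hw : LinearIndependent k w) :
    ∃ σ : Fin r → Fin (d + 1), ((coeffMatrix w).submatrix id σ).det ≠ 0 := by
  have hrow : LinearIndependent k (coeffMatrix w).row :=
    hw.map' (coordEquiv k d).toLinearMap (coordEquiv k d).ker
  have hrank : Module.finrank k (Submodule.span k (Set.range (coeffMatrix w).col)) = r := by
    rw [← Matrix.rank_eq_finrank_span_cols, hrow.rank_matrix, Fintype.card_fin]
  obtain ⟨f, hf, -, hli⟩ := Submodule.exists_fun_fin_finrank_span_eq k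
    (Set.range (coeffMatrix w).col)
  choose σ hσ using hf
  refine ⟨fun i => σ (Fin.cast hrank.symm i), ?_⟩
  rw [← isUnit_iff_ne_zero, ← Matrix.isUnit_iff_isUnit_det,
    ← Matrix.linearIndependent_cols_iff_isUnit]
  have hcol : ((coeffMatrix w).submatrix id fun i => σ (Fin.cast hrank.symm i)).col =
      f ∘ Fin.cast hrank.symm := funext fun i => hσ _
  rw [hcol]
  exact hli.comp _ (Fin.cast_injective hrank.symm)

variable {H : ℕ →₀ ℕ}

lemma plueckerCoord_eq (w : ∀ d : H.support, Fin (d + 1 - H d) → Forms k d)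
    (s : PlueckerIndex H) :
    plueckerCoord w s = ((coeffMatrix (w s.1)).submatrix id s.2).det := by
  rw [plueckerCoord]
  congr 1
  ext i j
  simp [coeffMatrix, coordEquiv_apply]

lemma isMultihomogeneous_X (s : PlueckerIndex H) :
    IsMultihomogeneous (MvPolynomial.X s : MvPolynomial (PlueckerIndex H) k) (Pi.single s.1 1) :=
  MvPolynomial.isWeightedHomogeneous_X _ _ _

/-- The minor on an arbitrary family of columns is, up to sign, zero or a Plücker coordinate. -/
lemma exists_minor_polynomial (d : H.support) (σ : Fin (d + 1 - H d) → Fin (d + 1)) :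
    ∃ F : MvPolynomial (PlueckerIndex H) k, IsMultihomogeneous F (Pi.single d 1) ∧
      ∀ w : ∀ d : H.support, Fin (d + 1 - H d) → Forms k d,
        MvPolynomial.eval (plueckerCoord w) F = ((coeffMatrix (w d)).submatrix id σ).det := by
  by_cases hσ : Function.Injective σ
  · have hmono : StrictMono (σ ∘ Tuple.sort σ) :=
      (Tuple.monotone_sort σ).strictMono_of_injective (hσ.comp (Tuple.sort σ).injective)
    let s : PlueckerIndex H := ⟨d, OrderEmbedding.ofStrictMono _ hmono⟩
    refine ⟨MvPolynomial.C ((Equiv.Perm.sign (Tuple.sort σ) : ℤ) : k) * MvPolynomial.X s,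
      (isMultihomogeneous_X s).C_mul _, fun w => ?_⟩
    have h := Matrix.det_permute' (Tuple.sort σ) ((coeffMatrix (w d)).submatrix id σ)
    have h2 : plueckerCoord w s = ((Equiv.Perm.sign (Tuple.sort σ) : ℤ) : k) *
        ((coeffMatrix (w d)).submatrix id σ).det := by
      rw [plueckerCoord_eq, ← h]
      rfl
    rw [map_mul, MvPolynomial.eval_C, MvPolynomial.eval_X, h2, ← mul_assoc, ← Int.cast_mul,
      ← Units.val_mul, Int.units_mul_self]
    simp
  · refine ⟨0, MvPolynomial.isWeightedHomogeneous_zero _ _ _, fun w => ?_⟩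
    obtain ⟨i, j, hij, hne⟩ : ∃ i j, σ i = σ j ∧ i ≠ j := by
      simpa [Function.Injective] using hσ
    rw [map_zero, Matrix.det_zero_of_column_eq hne]
    intro l
    simp [hij]

lemma eval_scale {f : MvPolynomial (PlueckerIndex H) k} {e : H.support → ℕ}
    (hf : IsMultihomogeneous f e) (c : H.support → k) (p : PlueckerIndex H → k) :
    MvPolynomial.eval (fun s => c s.1 * p s) f = (∏ d, c d ^ e d) * MvPolynomial.eval p f := by
  refine MvPolynomial.IsWeightedHomogeneous.induction_on
    (motive := fun f _ => MvPolynomial.eval (fun s => c s.1 * p s) f =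
      (∏ d, c d ^ e d) * MvPolynomial.eval p f) ?_ ?_ ?_ hf
  · simp
  · intro f g _ _ hf hg
    rw [map_add, map_add, hf, hg, mul_add]
  · intro m a hm
    have hprod : m.prod (fun s n => c s.1 ^ n) = ∏ d, c d ^ e d := by
      rw [← hm, Finsupp.prod]
      have : ∀ d : H.support, c d ^ (Finsupp.weight (fun s : PlueckerIndex H =>
          (Pi.single s.1 1 : H.support → ℕ)) m d) =
          ∏ s ∈ m.support, if d = s.1 then c d ^ m s else 1 := by
        intro d
        rw [Finsupp.weight_apply, Finsupp.sum, Finset.sum_apply, ← Finset.prod_pow_eq_pow_sum]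
        refine Finset.prod_congr rfl fun s _ => ?_
        by_cases h : d = s.1 <;> simp [h]
      rw [Finset.prod_congr rfl fun d _ => this d, Finset.prod_comm]
      refine Finset.prod_congr rfl fun s _ => ?_
      simp
    rw [MvPolynomial.eval_monomial, MvPolynomial.eval_monomial, ← hprod]
    simp only [mul_pow, Finsupp.prod_mul]
    ring

/-- A change of bases multiplies the Plücker coordinates in every degree by a constant. -/
lemma exists_plueckerCoord_eq_mul {W : ∀ d : H.support, Submodule k (Forms k d)}
    {w w' : ∀ d : H.support, Fin (d + 1 - H d) → Forms k d}
    (hw : ∀ d, IsFrame (W d) (w d)) (hw' : ∀ d, IsFrame (W d) (w' d)) :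
    ∃ c : H.support → k, plueckerCoord w' = fun s => c s.1 * plueckerCoord w s := by
  have h : ∀ d : H.support, ∃ A : Matrix (Fin (d + 1 - H d)) (Fin (d + 1 - H d)) k,
      coeffMatrix (w' d) = A * coeffMatrix (w d) := by
    intro d
    have hmem : ∀ i, w' d i ∈ Submodule.span k (Set.range (w d)) := fun i => by
      rw [(hw d).2, ← (hw' d).2]
      exact Submodule.subset_span ⟨i, rfl⟩
    choose A hA using fun i => Submodule.mem_span_range_iff_exists_fun k |>.mp (hmem i)
    refine ⟨Matrix.of A, ?_⟩
    ext i j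
    have h1 : coeffMatrix (w' d) i = coordEquiv k d (w' d i) := rfl
    rw [h1, ← hA i, ← vecMul_coeffMatrix]
    rfl
  choose A hA using h
  refine ⟨fun d => (A d).det, funext fun s => ?_⟩
  rw [plueckerCoord_eq, plueckerCoord_eq, hA, ← Matrix.det_mul]
  rfl

lemma exists_isFrame_of_finrank_eq {V : Type*} [AddCommGroup V] [Module k V]
    [FiniteDimensional k V] {W : Submodule k V} {r : ℕ} (h : Module.finrank k W = r) :
    ∃ w : Fin r → V, IsFrame W w := by
  let b := Module.finBasisOfFinrankEq k W h
  refine ⟨fun i => b i, b.linearIndependent.map' W.subtype (Submodule.ker_subtype _), ?_⟩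
  have := congrArg (Submodule.map W.subtype) b.span_eq
  rwa [Submodule.map_span, Submodule.map_top, Submodule.range_subtype, ← Set.range_comp] at this

lemma exists_isFrame (I : Variety k H) (d : ℕ) :
    ∃ w : Fin (d + 1 - H d) → Forms k d, IsFrame (gradedPart I.1 d) w :=
  exists_isFrame_of_finrank_eq (by have := finrank_gradedPart I d; omega)

/-- A choice of bases of the graded parts of an ideal. -/
noncomputable def frame (I : Variety k H) (d : H.support) : Fin (d + 1 - H d) → Forms k d :=
  (exists_isFrame I d).choose

lemma isFrame_frame (I : Variety k H) (d : H.support) : IsFrame (gradedPart I.1 d) (frame I d) :=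
  (exists_isFrame I d).choose_spec

/-- The value of a polynomial in the Plücker coordinates, for the chosen bases. -/
noncomputable def plueckerEval (f : MvPolynomial (PlueckerIndex H) k) (I : Variety k H) : k :=
  MvPolynomial.eval (plueckerCoord (frame I)) f

lemma toGrassProduct_mem_basicOpen {f : MvPolynomial (PlueckerIndex H) k} {e : H.support → ℕ}
    (hf : IsMultihomogeneous f e) (I : Variety k H) :
    toGrassProduct I ∈ basicOpen f ↔ plueckerEval f I ≠ 0 := by
  constructor
  · rintro ⟨w, hw, hne⟩
    obtain ⟨c, hc⟩ := exists_plueckerCoord_eq_mul (W := fun d => gradedPart I.1 d)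
      (isFrame_frame I) hw
    rw [hc, eval_scale hf] at hne
    exact right_ne_zero_of_mul hne
  · intro h
    exact ⟨frame I, isFrame_frame I, h⟩

lemma eventually_plueckerEval_ne_zero {f : MvPolynomial (PlueckerIndex H) k} {e : H.support → ℕ}
    (hf : IsMultihomogeneous f e) {K : Variety k H} (hK : plueckerEval f K ≠ 0) :
    ∀ᶠ I in nhds K, plueckerEval f I ≠ 0 := by
  have hopen : IsOpen (toGrassProduct ⁻¹' basicOpen f : Set (Variety k H)) :=
    isOpen_induced (TopologicalSpace.isOpen_generateFrom_of_mem ⟨f, e, hf, rfl⟩)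
  filter_upwards [hopen.mem_nhds ((toGrassProduct_mem_basicOpen hf K).mpr hK)] with I hI
  exact (toGrassProduct_mem_basicOpen hf I).mp hI

/-- Every element of the slice of `K` extends to a rational section of the slices of the ideals
near `K`: its coordinates are quotients of forms in the Plücker coordinates, by Cramer's rule. -/
lemma exists_section (K : Variety k H) (d : H.support) {p : k[X]} (hp : p ∈ slice K.1 d) :
    ∃ (G : MvPolynomial (PlueckerIndex H) k) (F : Fin (d + 1) → MvPolynomial (PlueckerIndex H) k),
      IsMultihomogeneous G (Pi.single d 1) ∧ (∀ c, IsMultihomogeneous (F c) (Pi.single d 1)) ∧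
      plueckerEval G K ≠ 0 ∧ (∀ c, plueckerEval (F c) K = p.coeff c * plueckerEval G K) ∧
      ∀ I : Variety k H, ∃ q ∈ slice I.1 d, ∀ c : Fin (d + 1), q.coeff c = plueckerEval (F c) I := by
  classical
  obtain ⟨hpd, hpK⟩ := mem_dehomogenize.mp hp
  obtain ⟨σ, hσ⟩ := exists_det_ne_zero (isFrame_frame K d).1
  choose F hF hFeval using fun σ => exists_minor_polynomial (k := k) d σ
  -- with `M` the coefficient matrix of the frame and `N` its minor on the columns `σ`, the section is
  -- `p_σ * adj N * M`; its entries are sums of minors of `M` with one column of `N` replaced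
  have hsum : ∀ (I : Variety k H) (c : Fin (d + 1)),
      plueckerEval (∑ j, MvPolynomial.C (p.coeff (σ j)) * F (Function.update σ j c)) I =
      Matrix.vecMul (Matrix.vecMul (fun j => p.coeff (σ j))
        ((coeffMatrix (frame I d)).submatrix id σ).adjugate) (coeffMatrix (frame I d)) c := by
    intro I c
    rw [plueckerEval, map_sum, Matrix.vecMul_vecMul, Matrix.vecMul, dotProduct]
    refine Finset.sum_congr rfl fun j _ => ?_
    rw [map_mul, MvPolynomial.eval_C, hFeval]
    congr 1
    have h1 : (((coeffMatrix (frame I d)).submatrix id σ).adjugate * coeffMatrix (frame I d)) j c =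
        Matrix.mulVec ((coeffMatrix (frame I d)).submatrix id σ).adjugate
          (fun i => coeffMatrix (frame I d) i c) j := rfl
    rw [h1, ← Matrix.cramer_eq_adjugate_mulVec, Matrix.cramer_apply]
    congr 1
    ext i l
    by_cases h : l = j
    · subst h; simp
    · simp [h]
  refine ⟨F σ, fun c => ∑ j, MvPolynomial.C (p.coeff (σ j)) * F (Function.update σ j c), hF σ,
    fun c => MvPolynomial.IsWeightedHomogeneous.sum _ _ _ fun j _ => (hF _).C_mul _, ?_, ?_, ?_⟩
  · rwa [plueckerEval, hFeval]
  · intro c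
    obtain ⟨α, hα⟩ := (Submodule.mem_span_range_iff_exists_fun k).mp
      ((isFrame_frame K d).2.symm ▸ hpK)
    have hvec : Matrix.vecMul α (coeffMatrix (frame K d)) =
        fun j : Fin (d + 1) => p.coeff j := by
      rw [vecMul_coeffMatrix, hα]
      exact funext fun j => coordEquiv_formsEquiv _ j
    have hvecσ : (fun j => p.coeff (σ j)) =
        Matrix.vecMul α ((coeffMatrix (frame K d)).submatrix id σ) := by
      ext j
      exact (congrFun hvec (σ j)).symm
    rw [hsum, hvecσ, Matrix.vecMul_vecMul (v := α), Matrix.mul_adjugate, Matrix.vecMul_smul,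
      Matrix.vecMul_one, Matrix.smul_vecMul, hvec, plueckerEval, hFeval, Pi.smul_apply,
      smul_eq_mul, mul_comm]
  · intro I
    set β := Matrix.vecMul (fun j => p.coeff (σ j))
        ((coeffMatrix (frame I d)).submatrix id σ).adjugate with hβ
    obtain ⟨q, hq⟩ := (formsEquiv k d).surjective (∑ i, β i • frame I d i)
    refine ⟨q, mem_dehomogenize.mpr ⟨q.2, ?_⟩, fun c => ?_⟩
    · change formsEquiv k d q ∈ _
      rw [hq, ← (isFrame_frame I d).2]
      exact Submodule.sum_mem _ fun i _ => Submodule.smul_mem _ _ (Submodule.subset_span ⟨i, rfl⟩)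
    · rw [hsum, ← hβ, vecMul_coeffMatrix, ← hq, coordEquiv_formsEquiv]

end Pluecker

/-! ### A valuation centred at a point of the closure -/

section Centre

variable {k : Type*} [Field k] {H : ℕ →₀ ℕ} (u : Ultrafilter (Variety k H)) (K : Variety k H)

/-- The germ along `u` of the value of a polynomial in the Plücker coordinates. -/
noncomputable def plueckerGerm (f : MvPolynomial (PlueckerIndex H) k) :
    (u : Filter (Variety k H)).Germ k :=
  ((plueckerEval f : Variety k H → k) : (u : Filter (Variety k H)).Germ k)

lemma plueckerGerm_add (f g : MvPolynomial (PlueckerIndex H) k) :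
    plueckerGerm u (f + g) = plueckerGerm u f + plueckerGerm u g := by
  simp only [plueckerGerm, ← Filter.Germ.coe_add]
  congr 1
  exact funext fun I => map_add _ f g

lemma plueckerGerm_mul (f g : MvPolynomial (PlueckerIndex H) k) :
    plueckerGerm u (f * g) = plueckerGerm u f * plueckerGerm u g := by
  simp only [plueckerGerm, ← Filter.Germ.coe_mul]
  congr 1
  exact funext fun I => map_mul _ f g

lemma plueckerGerm_C (c : k) :
    plueckerGerm u (MvPolynomial.C c : MvPolynomial (PlueckerIndex H) k) = ↑c := by
  rw [plueckerGerm]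
  refine congrArg _ (funext fun I => MvPolynomial.eval_C c)

lemma plueckerGerm_sub (f g : MvPolynomial (PlueckerIndex H) k) :
    plueckerGerm u (f - g) = plueckerGerm u f - plueckerGerm u g := by
  rw [eq_sub_iff_add_eq, ← plueckerGerm_add, sub_add_cancel]

variable {u K}

lemma plueckerGerm_ne_zero (hu : (u : Filter (Variety k H)) ≤ nhds K)
    {f : MvPolynomial (PlueckerIndex H) k} {e : H.support → ℕ}
    (hf : IsMultihomogeneous f e) (hK : plueckerEval f K ≠ 0) : plueckerGerm u f ≠ 0 := by
  intro h0
  have h1 : ∀ᶠ I in (u : Filter (Variety k H)), plueckerEval f I = 0 := Filter.Germ.coe_eq.mp h0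
  obtain ⟨I, hI, hI'⟩ := (h1.and (hu (eventually_plueckerEval_ne_zero hf hK))).exists
  exact hI' hI

variable (u K) in
/-- The germs of the rational functions that are defined at `K`: quotients of multihomogeneous
polynomials of the same multidegree in the Plücker coordinates. -/
def regularGerms : Subring ((u : Filter (Variety k H)).Germ k) where
  carrier := {x | ∃ F G e, IsMultihomogeneous F e ∧ IsMultihomogeneous G e ∧
    plueckerEval G K ≠ 0 ∧ x * plueckerGerm u G = plueckerGerm u F}
  mul_mem' := by
    rintro x y ⟨F, G, e, hF, hG, hK, h⟩ ⟨F', G', e', hF', hG', hK', h'⟩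
    refine ⟨F * F', G * G', e + e', hF.mul hF', hG.mul hG', ?_, ?_⟩
    · simpa [plueckerEval] using ⟨hK, hK'⟩
    · rw [plueckerGerm_mul, plueckerGerm_mul, ← h, ← h']; ring
  one_mem' := ⟨1, 1, 0, MvPolynomial.isWeightedHomogeneous_one _ _,
    MvPolynomial.isWeightedHomogeneous_one _ _, by simp [plueckerEval], one_mul _⟩
  add_mem' := by
    rintro x y ⟨F, G, e, hF, hG, hK, h⟩ ⟨F', G', e', hF', hG', hK', h'⟩
    refine ⟨F * G' + G * F', G * G', e + e', (hF.mul hG').add (hG.mul hF'), hG.mul hG', ?_, ?_⟩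
    · simpa [plueckerEval] using ⟨hK, hK'⟩
    · rw [plueckerGerm_add, plueckerGerm_mul, plueckerGerm_mul, plueckerGerm_mul, ← h, ← h']; ring
  zero_mem' := ⟨0, 1, 0, MvPolynomial.isWeightedHomogeneous_zero _ _ _,
    MvPolynomial.isWeightedHomogeneous_one _ _, by simp [plueckerEval], by
      rw [zero_mul, eq_comm, ← map_zero MvPolynomial.C, plueckerGerm_C]; rfl⟩
  neg_mem' := by
    rintro x ⟨F, G, e, hF, hG, hK, h⟩
    refine ⟨-F, G, e, hF.neg, hG, hK, ?_⟩
    rw [neg_mul, h, ← zero_sub F, plueckerGerm_sub, ← map_zero MvPolynomial.C, plueckerGerm_C]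
    exact (zero_sub _).symm

variable (u K) in
/-- The germs of the rational functions that vanish at `K`. -/
def vanishingGerms : Ideal (regularGerms u K) where
  carrier := {x | ∃ F G e, IsMultihomogeneous F e ∧ IsMultihomogeneous G e ∧
    plueckerEval G K ≠ 0 ∧ plueckerEval F K = 0 ∧
    (x : (u : Filter (Variety k H)).Germ k) * plueckerGerm u G = plueckerGerm u F}
  add_mem' := by
    rintro x y ⟨F, G, e, hF, hG, hK, h0, h⟩ ⟨F', G', e', hF', hG', hK', h0', h'⟩
    refine ⟨F * G' + G * F', G * G', e + e', (hF.mul hG').add (hG.mul hF'), hG.mul hG', ?_, ?_, ?_⟩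
    · simpa [plueckerEval] using ⟨hK, hK'⟩
    · rw [plueckerEval] at h0 h0' ⊢
      rw [map_add, map_mul, map_mul, h0, h0', zero_mul, mul_zero, add_zero]
    · rw [plueckerGerm_add, plueckerGerm_mul, plueckerGerm_mul, plueckerGerm_mul, ← h, ← h',
        Subring.coe_add]
      ring
  zero_mem' := ⟨0, 1, 0, MvPolynomial.isWeightedHomogeneous_zero _ _ _,
    MvPolynomial.isWeightedHomogeneous_one _ _, by simp [plueckerEval], by simp [plueckerEval], by
      rw [Subring.coe_zero, zero_mul, eq_comm, ← map_zero MvPolynomial.C, plueckerGerm_C]; rfl⟩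
  smul_mem' := by
    rintro y x ⟨F, G, e, hF, hG, hK, h0, h⟩
    obtain ⟨F', G', e', hF', hG', hK', h'⟩ := y.2
    refine ⟨F' * F, G' * G, e' + e, hF'.mul hF, hG'.mul hG, ?_, ?_, ?_⟩
    · simpa [plueckerEval] using ⟨hK', hK⟩
    · rw [plueckerEval] at h0 ⊢
      rw [map_mul, h0, mul_zero]
    · rw [plueckerGerm_mul, plueckerGerm_mul, ← h, ← h', smul_eq_mul, Subring.coe_mul]
      ring

lemma vanishingGerms_ne_top (hu : (u : Filter (Variety k H)) ≤ nhds K) :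
    vanishingGerms u K ≠ ⊤ := by
  rw [Ideal.ne_top_iff_one]
  rintro ⟨F, G, e, hF, hG, hK, h0, h⟩
  rw [Subring.coe_one, one_mul] at h
  have hne : plueckerEval (G - F) K ≠ 0 := by
    rw [plueckerEval] at h0 hK ⊢
    rwa [map_sub, h0, sub_zero]
  exact plueckerGerm_ne_zero hu (hG.sub hF) hne (by rw [plueckerGerm_sub, h, sub_self])

/-- A point in the closure is the centre of a valuation: if `u` converges to `K`, there is a
valuation on the field of germs along `u`, trivial on constants, such that every rational function
defined at `K` is congruent to its value at `K`. -/
lemma exists_valuation (hu : (u : Filter (Variety k H)) ≤ nhds K) :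
    ∃ V : ValuationSubring ((u : Filter (Variety k H)).Germ k),
      (∀ c : k, c ≠ 0 → V.valuation (↑c : (u : Filter (Variety k H)).Germ k) = 1) ∧
      ∀ F G e, IsMultihomogeneous F e → IsMultihomogeneous G e → plueckerEval G K ≠ 0 →
        ∀ c : k, plueckerEval F K = c * plueckerEval G K →
        V.valuation (plueckerGerm u F / plueckerGerm u G - ↑c) < 1 := by
  obtain ⟨V, hV, hV'⟩ := Ideal.image_subset_nonunits_valuationSubring (vanishingGerms u K)
    (vanishingGerms_ne_top hu)
  refine ⟨V, fun c hc => ?_, fun F G e hF hG hK c h => ?_⟩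
  · have hle : ∀ c : k, V.valuation (↑c : (u : Filter (Variety k H)).Germ k) ≤ 1 := fun c => by
      rw [ValuationSubring.valuation_le_one_iff]
      refine hV ⟨MvPolynomial.C c, 1, 0, MvPolynomial.isWeightedHomogeneous_C _ _,
        MvPolynomial.isWeightedHomogeneous_one _ _, by simp [plueckerEval], ?_⟩
      rw [plueckerGerm_C, ← map_one MvPolynomial.C, plueckerGerm_C]
      exact mul_one _
    refine le_antisymm (hle c) ?_
    have h1 := hle c⁻¹
    rw [Filter.Germ.const_inv, map_inv₀] at h1
    have hc0 : (↑c : (u : Filter (Variety k H)).Germ k) ≠ 0 := fun h =>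
      hc (Filter.Germ.const_inj.mp h)
    exact (inv_le_one₀ (zero_lt_iff.mpr ((Valuation.ne_zero_iff _).mpr hc0))).mp h1
  · have hG0 := plueckerGerm_ne_zero hu hG hK
    have hFG : IsMultihomogeneous (F - MvPolynomial.C c * G) e := hF.sub (hG.C_mul c)
    have heq : (plueckerGerm u F / plueckerGerm u G - ↑c) * plueckerGerm u G =
        plueckerGerm u (F - MvPolynomial.C c * G) := by
      rw [plueckerGerm_sub, plueckerGerm_mul, plueckerGerm_C, sub_mul, div_mul_cancel₀ _ hG0]
    have h0 : plueckerEval (F - MvPolynomial.C c * G) K = 0 := by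
      rw [plueckerEval] at h ⊢
      rw [map_sub, map_mul, MvPolynomial.eval_C, h, sub_eq_zero]
      rfl
    rw [← ValuationSubring.mem_nonunits_iff]
    exact hV' ⟨⟨_, _, G, e, hFG, hG, hK, heq⟩, ⟨_, G, e, hFG, hG, hK, h0, heq⟩, rfl⟩

end Centre

/-! ### The ultraproduct of the ideals -/

section Limit

variable {k : Type*} [Field k] {H : ℕ →₀ ℕ} (u : Ultrafilter (Variety k H))

/-- The ultraproduct along `u` of the dehomogenized degree `d` parts of the ideals: the polynomials
whose coefficients are the germs of the coefficients of a family of elements of these parts. It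
plays the role of the degree `d` part of a generic ideal. -/
def limitSlice (d : ℕ) :
    Submodule ((u : Filter (Variety k H)).Germ k) ((u : Filter (Variety k H)).Germ k)[X] where
  carrier := {P | ∃ p : Variety k H → k[X], (∀ I, p I ∈ slice I.1 d) ∧
    ∀ j, P.coeff j = ((fun I => (p I).coeff j : Variety k H → k) :
      (u : Filter (Variety k H)).Germ k)}
  add_mem' := by
    rintro P Q ⟨p, hp, hP⟩ ⟨q, hq, hQ⟩
    refine ⟨fun I => p I + q I, fun I => Submodule.add_mem _ (hp I) (hq I), fun j => ?_⟩
    rw [coeff_add, hP, hQ, ← Filter.Germ.coe_add]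
    exact congrArg _ (funext fun I => (coeff_add _ _ _).symm)
  zero_mem' := ⟨fun _ => 0, fun _ => Submodule.zero_mem _, fun j => by simp; rfl⟩
  smul_mem' := by
    rintro c P ⟨p, hp, hP⟩
    induction c using Filter.Germ.inductionOn with | _ c
    refine ⟨fun I => c I • p I, fun I => Submodule.smul_mem _ _ (hp I), fun j => ?_⟩
    rw [coeff_smul, hP, smul_eq_mul, ← Filter.Germ.coe_mul]
    exact congrArg _ (funext fun I => (coeff_smul (c I) (p I) j).symm)

variable {u}

lemma coeff_eq_zero_of_mem_slice {I : Variety k H} {d j : ℕ} {p : k[X]} (hp : p ∈ slice I.1 d)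
    (hj : d < j) : p.coeff j = 0 :=
  (degree_lt_iff_coeff_zero _ _).mp (mem_degreeLT.mp (slice_le _ _ hp)) j hj

lemma limitSlice_le (d : ℕ) : limitSlice u d ≤ degreeLT _ (d + 1) := by
  rintro P ⟨p, hp, hP⟩
  rw [mem_degreeLT, degree_lt_iff_coeff_zero]
  intro j hj
  rw [hP, show (fun I => (p I).coeff j) = fun _ => 0 from
    funext fun I => coeff_eq_zero_of_mem_slice (hp I) hj]
  rfl

lemma limitSlice_le_succ (d : ℕ) : limitSlice u d ≤ limitSlice u (d + 1) := by
  rintro P ⟨p, hp, hP⟩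
  exact ⟨p, fun I => slice_le_succ _ _ (hp I), hP⟩

lemma X_mul_mem_limitSlice {d : ℕ} {P : ((u : Filter (Variety k H)).Germ k)[X]}
    (h : P ∈ limitSlice u d) : X * P ∈ limitSlice u (d + 1) := by
  obtain ⟨p, hp, hP⟩ := h
  refine ⟨fun I => X * p I, fun I => X_mul_mem_slice (hp I), fun j => ?_⟩
  cases j with
  | zero => simp; rfl
  | succ j => simp [hP]

instance (d : ℕ) : FiniteDimensional ((u : Filter (Variety k H)).Germ k) (limitSlice u d) :=
  Submodule.finiteDimensional_of_le (limitSlice_le d)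

lemma exists_mem_limitSlice {d : ℕ} {p : Variety k H → k[X]} (hp : ∀ I, p I ∈ slice I.1 d) :
    ∃ P ∈ limitSlice u d, ∀ j, P.coeff j = ((fun I => (p I).coeff j : Variety k H → k) :
      (u : Filter (Variety k H)).Germ k) := by
  have hcoeff : ∀ j, (∑ i ∈ Finset.range (d + 1), monomial i ((fun I => (p I).coeff i :
      Variety k H → k) : (u : Filter (Variety k H)).Germ k)).coeff j =
      ((fun I => (p I).coeff j : Variety k H → k) : (u : Filter (Variety k H)).Germ k) := by
    intro j
    simp only [finsetSum_coeff, coeff_monomial, Finset.sum_ite_eq', Finset.mem_range]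
    split_ifs with hj
    · rfl
    · rw [show (fun I => (p I).coeff j) = fun _ => 0 from
        funext fun I => coeff_eq_zero_of_mem_slice (hp I) (by omega)]
      rfl
  exact ⟨_, ⟨p, hp, hcoeff⟩, hcoeff⟩

lemma germ_ne_zero_iff {f : Variety k H → k} :
    (f : (u : Filter (Variety k H)).Germ k) ≠ 0 ↔ ∀ᶠ I in (u : Filter (Variety k H)), f I ≠ 0 := by
  rw [Ultrafilter.eventually_not]
  exact not_congr Filter.Germ.coe_eq

/-- If `u` contains a set of ideals whose degree `d` parts have the same degrees, the ultraproduct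
has these degrees too. -/
lemma degrees_limitSlice {d : ℕ} {S : Set ℕ}
    (hS : ∀ᶠ I : Variety k H in (u : Filter (Variety k H)), degrees (slice I.1 d) = S) :
    degrees (limitSlice u d) = S := by
  classical
  ext j
  constructor
  · rintro ⟨P, ⟨p, hp, hP⟩, hP0, rfl⟩
    have h1 : ∀ᶠ I in (u : Filter (Variety k H)), (p I).coeff P.natDegree ≠ 0 := by
      rw [← germ_ne_zero_iff, ← hP]
      simpa using hP0
    have h2 : ∀ᶠ I in (u : Filter (Variety k H)), ∀ c ∈ Finset.range (d + 1), P.natDegree < c →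
        (p I).coeff c = 0 := by
      rw [Filter.eventually_all_finset]
      intro c _
      by_cases hc : P.natDegree < c
      · have := hP c
        rw [coeff_eq_zero_of_natDegree_lt hc, eq_comm] at this
        filter_upwards [Filter.Germ.coe_eq.mp this] with I hI _ using hI
      · exact Filter.Eventually.of_forall fun I h => absurd h hc
    obtain ⟨I, hI1, hI2, hI3⟩ := (h1.and (h2.and hS)).exists
    rw [← hI3]
    refine ⟨p I, hp I, fun h => hI1 (by simp [h]), le_antisymm ?_ (le_natDegree_of_ne_zero hI1)⟩
    rw [natDegree_le_iff_coeff_eq_zero]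
    intro c hc
    by_cases hcd : c ≤ d
    · exact hI2 c (Finset.mem_range.mpr (by omega)) hc
    · exact coeff_eq_zero_of_mem_slice (hp I) (by omega)
  · intro hj
    have hex : ∀ I : Variety k H, ∃ p ∈ slice I.1 d, degrees (slice I.1 d) = S →
        p ≠ 0 ∧ p.natDegree = j := by
      intro I
      by_cases h : degrees (slice I.1 d) = S
      · obtain ⟨p, hp, hp'⟩ := h.symm ▸ hj
        exact ⟨p, hp, fun _ => hp'⟩
      · exact ⟨0, Submodule.zero_mem _, fun h' => absurd h' h⟩
    choose p hp hpj using hex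
    obtain ⟨P, hPmem, hP⟩ := exists_mem_limitSlice (u := u) hp
    have hPj : P.coeff j ≠ 0 := by
      rw [hP, germ_ne_zero_iff]
      filter_upwards [hS] with I hI
      obtain ⟨h0, rfl⟩ := hpj I hI
      simpa using h0
    refine ⟨P, hPmem, fun h => hPj (by simp [h]), le_antisymm ?_ (le_natDegree_of_ne_zero hPj)⟩
    rw [natDegree_le_iff_coeff_eq_zero]
    intro c hc
    rw [hP]
    refine Filter.Germ.coe_eq.mpr ?_
    filter_upwards [hS] with I hI
    exact coeff_eq_zero_of_natDegree_lt ((hpj I hI).2.trans_lt hc)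

/-- Every element of the slice of a limit `K` of `u` is the reduction of an element of the
ultraproduct. -/
lemma exists_lift {K : Variety k H}
    {V : ValuationSubring ((u : Filter (Variety k H)).Germ k)}
    (hV : ∀ F G e, IsMultihomogeneous F e → IsMultihomogeneous G e → plueckerEval G K ≠ 0 →
        ∀ c : k, plueckerEval F K = c * plueckerEval G K →
        V.valuation (plueckerGerm u F / plueckerGerm u G - ↑c) < 1)
    {d : ℕ} {p : k[X]} (hp : p ∈ slice K.1 d) :
    ∃ P ∈ limitSlice u d, ∀ c, V.valuation (P.coeff c - ↑(p.coeff c)) < 1 := by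
  by_cases hd : H d = 0
  · obtain ⟨P, hPmem, hP⟩ := exists_mem_limitSlice (u := u) (d := d) (p := fun _ => p) fun I => by
      rw [slice_eq_of_eq_zero I hd]; exact slice_le _ _ hp
    refine ⟨P, hPmem, fun c => ?_⟩
    rw [hP, show ((fun _ : Variety k H => p.coeff c : Variety k H → k) :
      (u : Filter (Variety k H)).Germ k) = ↑(p.coeff c) from rfl, sub_self, map_zero]
    exact zero_lt_one
  · obtain ⟨G, F, hG, hF, hGK, hFK, hq⟩ := exists_section K ⟨d, Finsupp.mem_support_iff.mpr hd⟩ hp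
    choose q hq hqF using hq
    obtain ⟨P, hPmem, hP⟩ := exists_mem_limitSlice (u := u) (d := d)
      (p := fun I => (plueckerEval G I)⁻¹ • q I) fun I => Submodule.smul_mem _ _ (hq I)
    refine ⟨P, hPmem, fun c => ?_⟩
    by_cases hc : c < d + 1
    · have hPc : P.coeff c = plueckerGerm u (F ⟨c, hc⟩) / plueckerGerm u G := by
        rw [hP, plueckerGerm, plueckerGerm, ← Filter.Germ.coe_div]
        refine congrArg _ (funext fun I => ?_)
        rw [coeff_smul, hqF I ⟨c, hc⟩, smul_eq_mul, Pi.div_apply, div_eq_inv_mul]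
      rw [hPc]
      exact hV _ _ _ (hF _) hG hGK _ (hFK _)
    · rw [(degree_lt_iff_coeff_zero _ _).mp (mem_degreeLT.mp (limitSlice_le d hPmem)) c (by omega),
        coeff_eq_zero_of_mem_slice hp (by omega),
        show ((↑(0 : k) : (u : Filter (Variety k H)).Germ k)) = 0 from rfl, sub_self, map_zero]
      exact zero_lt_one

/-- The reduction of the ultraproduct has the degrees of the slice of the limit: it contains this
slice and has the same dimension. -/
lemma leads_limitSlice {I K : Variety k H}
    {V : ValuationSubring ((u : Filter (Variety k H)).Germ k)}
    (hV1 : ∀ c : k, c ≠ 0 → V.valuation (↑c : (u : Filter (Variety k H)).Germ k) = 1)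
    (hV : ∀ F G e, IsMultihomogeneous F e → IsMultihomogeneous G e → plueckerEval G K ≠ 0 →
        ∀ c : k, plueckerEval F K = c * plueckerEval G K →
        V.valuation (plueckerGerm u F / plueckerGerm u G - ↑c) < 1)
    {d : ℕ} (hI : degrees (limitSlice u d) = degrees (slice I.1 d)) :
    leads V.valuation (limitSlice u d) = degrees (slice K.1 d) := by
  symm
  refine Set.eq_of_subset_of_ncard_le ?_ ?_ (finite_leads _ _)
  · rintro _ ⟨p, hp, hp0, rfl⟩
    obtain ⟨P, hP, hval⟩ := exists_lift hV hp
    have hlt : ∀ c, p.natDegree < c → V.valuation (P.coeff c) < 1 := fun c hc => by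
      have := hval c
      rwa [coeff_eq_zero_of_natDegree_lt hc,
        show ((↑(0 : k) : (u : Filter (Variety k H)).Germ k)) = 0 from rfl, sub_zero] at this
    have hle : ∀ c, V.valuation (P.coeff c) ≤ 1 := fun c => by
      rw [← sub_add_cancel (P.coeff c) (↑(p.coeff c))]
      refine (Valuation.map_add _ _ _).trans (max_le (hval c).le ?_)
      by_cases h0 : p.coeff c = 0
      · rw [h0, show ((↑(0 : k) : (u : Filter (Variety k H)).Germ k)) = 0 from rfl, map_zero]
        exact zero_le_one
      · exact (hV1 _ h0).le
    have heq : V.valuation (P.coeff p.natDegree) = 1 := by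
      have h1 := hV1 (p.coeff p.natDegree) (by simpa using hp0)
      have h2 := Valuation.map_add_eq_of_lt_left V.valuation ((hval p.natDegree).trans_eq h1.symm)
      rwa [add_sub_cancel, h1] at h2
    exact ⟨P, hP, fun c => heq.symm ▸ hle c, fun c hc => heq.symm ▸ hlt c hc⟩
  · rw [ncard_leads, ← ncard_degrees, hI, ncard_degrees, ncard_degrees, finrank_slice,
      finrank_slice]

end Limit

/-! ### The reverse plane partitions -/

section Degeneration

variable {k L Γ : Type*} [Field k] [Field L] [LinearOrderedCommGroupWithZero Γ]

/-- A degeneration of the monomial ideal `I` to the monomial ideal `J`, in dehomogenized form: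
the degree `d` parts `W d` of an ideal over a valued field `L` have the initial monomials of `I`,
and their reductions have the initial monomials of `J`. -/
structure IsDegeneration (v : Valuation L Γ) (W : ℕ → Submodule L L[X])
    (I J : Ideal (PolyRing k)) : Prop where
  le_degreeLT : ∀ d, W d ≤ degreeLT L (d + 1)
  le_succ : ∀ d, W d ≤ W (d + 1)
  X_mul_mem : ∀ d, ∀ p ∈ W d, X * p ∈ W (d + 1)
  mem_degrees_iff : ∀ d j, j ∈ degrees (W d) ↔ j ≤ d ∧ mon k (d - j) j ∈ I
  mem_leads_iff : ∀ d j, j ∈ leads v (W d) ↔ j ≤ d ∧ mon k (d - j) j ∈ J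

variable {v : Valuation L Γ} {W : ℕ → Submodule L L[X]} {I J : Ideal (PolyRing k)}

lemma IsDegeneration.finiteDimensional (h : IsDegeneration v W I J) (d : ℕ) :
    FiniteDimensional L (W d) := Submodule.finiteDimensional_of_le (h.le_degreeLT d)

/-- A degeneration yields a link: `x ^ a * y ^ b ∉ J` is moved to the monomial whose exponent of
`y` is the step at which `b` enters the reductions of the spaces `W d + F_i`, `d = a + b`. -/
theorem IsDegeneration.isLinked (h : IsDegeneration v W I J) : IsLinked I J := by
  set U : ℕ → ℕ → Submodule L L[X] := fun d i => W d ⊔ degreeLT L i with hU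
  have hfin : ∀ d i, FiniteDimensional L (U d i) := fun d i => by
    have := h.finiteDimensional d
    exact inferInstanceAs (FiniteDimensional L (W d ⊔ degreeLT L i : Submodule L L[X]))
  have hmono : ∀ d, Monotone (U d) := fun d i j hij => sup_le_sup_left (degreeLT_mono hij) _
  have htop : ∀ d b, b ∈ leads v (U d (d + 1)) ↔ b ≤ d := fun d b => by
    rw [hU]
    simp only [sup_eq_right.mpr (h.le_degreeLT d)]
    rw [mem_leads_degreeLT, Nat.lt_succ_iff]
  have hbot : ∀ d, U d 0 = W d := fun d => by
    rw [hU]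
    refine sup_eq_left.mpr fun p hp => ?_
    rw [degree_eq_bot.mp (Nat.WithBot.lt_zero_iff.mp (mem_degreeLT.mp hp))]
    exact Submodule.zero_mem _
  have himage : ∀ d, entryStep v (U d) '' {b | b ≤ d ∧ mon k (d - b) b ∉ J} =
      {i | i ≤ d ∧ mon k (d - i) i ∉ I} := fun d => by
    have h1 := image_entryStep (v := v) (hmono d) (hfin d) d
    convert h1 using 2
    · ext b
      rw [Set.mem_sdiff, htop, hbot, h.mem_leads_iff, Set.mem_ofPred_eq]
      tauto
    · ext i
      rw [sup_degreeLT_ne_iff, h.mem_degrees_iff]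
      tauto
  refine ⟨fun a b => (b : ℤ) - entryStep v (U (a + b)) b, ⟨fun a b _ _ => ?_, fun a b _ _ => ?_⟩,
    ?_⟩
  · have := entryStep_succ_le (v := v) (U := U (a + b)) (U' := U (a + b + 1)) (b := b)
      (i := a + b) (fun i p hp => ?_) ((htop _ _).mpr (by omega))
    · rw [add_assoc] at this
      push_cast
      omega
    · obtain ⟨w, hw, q, hq, rfl⟩ := Submodule.mem_sup.mp hp
      rw [mul_add]
      refine Submodule.add_mem_sup (h.X_mul_mem _ _ hw) ?_
      rw [mem_degreeLT, degree_lt_iff_coeff_zero]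
      intro m hm
      obtain ⟨m, rfl⟩ : ∃ n, m = n + 1 := ⟨m - 1, by omega⟩
      rw [coeff_X_mul]
      exact (degree_lt_iff_coeff_zero _ _).mp (mem_degreeLT.mp hq) m (by omega)
  · have := entryStep_le_of_le (v := v) (U := U (a + b)) (U' := U (a + b + 1)) (b := b)
      (i := a + b) (fun i => sup_le_sup_right (h.le_succ _) _) ((htop _ _).mpr (by omega))
    rw [add_right_comm] at this
    beta_reduce
    omega
  · ext ⟨s, t⟩
    constructor
    · rintro ⟨⟨a, b⟩, hab, hst⟩
      obtain ⟨b', ⟨hb', hJ⟩, heq⟩ := (himage (a + b)).symm ▸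
        (show b ∈ {i | i ≤ a + b ∧ mon k (a + b - i) i ∉ I} from
          ⟨by omega, by simpa [standardMonomials] using hab⟩)
      refine ⟨(a + b - b', b'), hJ, ?_⟩
      simp only [Prod.mk.injEq] at hst ⊢
      rw [Nat.sub_add_cancel hb', heq]
      omega
    · rintro ⟨⟨a, b⟩, hab, hst⟩
      obtain ⟨hle, hI⟩ := (himage (a + b)) ▸ Set.mem_image_of_mem (entryStep v (U (a + b)))
        (show b ∈ {i | i ≤ a + b ∧ mon k (a + b - i) i ∉ J} from
          ⟨by omega, by simpa [standardMonomials] using hab⟩)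
      refine ⟨(a + b - entryStep v (U (a + b)) b, entryStep v (U (a + b)) b), hI, ?_⟩
      simp only [Prod.mk.injEq] at hst ⊢
      omega

/-- A degeneration yields a link of the complements: `x ^ a * y ^ b ∈ J` is moved to the monomial
whose exponent of `y` is the step at which `b` enters the reductions of the spaces `W d ∩ F_i`,
`d = a + b`. -/
theorem IsDegeneration.isLinked_complement (h : IsDegeneration v W I J)
    (hcol : colength I = colength J)
    (hI : ∀ a b, colength I ≤ a + b → mon k a b ∈ I) :
    IsLinked (complement I) (complement J) := by
  set N := colength I with hN
  set U : ℕ → ℕ → Submodule L L[X] := fun d i => W d ⊓ degreeLT L i with hU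
  have hfin : ∀ d i, FiniteDimensional L (U d i) := fun d i =>
    Submodule.finiteDimensional_of_le (inf_le_right (a := W d))
  have hmono : ∀ d, Monotone (U d) := fun d i j hij => inf_le_inf_left _ (degreeLT_mono hij)
  have htop : ∀ d, U d (d + 1) = W d := fun d => inf_eq_left.mpr (h.le_degreeLT d)
  have hbot : ∀ d, leads v (U d 0) = ∅ := fun d =>
    Set.eq_empty_of_forall_notMem fun b hb =>
      absurd ((mem_leads_degreeLT v).mp (leads_mono v inf_le_right hb)) (Nat.not_lt_zero b)
  have himage : ∀ d, entryStep v (U d) '' {b | b ≤ d ∧ mon k (d - b) b ∈ J} =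
      {i | i ≤ d ∧ mon k (d - i) i ∈ I} := fun d => by
    have h1 := image_entryStep (v := v) (hmono d) (hfin d) d
    convert h1 using 2
    · ext b
      rw [hbot, Set.sdiff_empty, htop, h.mem_leads_iff, Set.mem_ofPred_eq]
    · ext i
      rw [inf_degreeLT_ne_iff, h.mem_degrees_iff]
      tauto
  -- in degrees at least `N` nothing moves
  have hlarge : ∀ d b, N ≤ d → b ≤ d → entryStep v (U d) b = b := fun d b hd hb => by
    have := h.finiteDimensional d
    have hW : W d = degreeLT L (d + 1) := by
      refine Submodule.eq_of_le_of_finrank_eq (h.le_degreeLT d) ?_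
      rw [← ncard_degrees, (degreeLTEquiv L _).finrank_eq, Module.finrank_fin_fun]
      have : degrees (W d) = (Finset.range (d + 1) : Set ℕ) := by
        ext j
        rw [h.mem_degrees_iff, Finset.mem_coe, Finset.mem_range, Nat.lt_succ_iff]
        exact and_iff_left_of_imp fun hj => hI _ _ (by omega)
      rw [this, Set.ncard_coe_finset, Finset.card_range]
    have hUd : ∀ i ≤ d, U d (i + 1) = degreeLT L (i + 1) := fun i hi => by
      rw [hU]
      simp only [hW]
      exact inf_eq_right.mpr (degreeLT_mono (by omega))
    have hmem : b ∈ leads v (U d (b + 1)) := by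
      rw [hUd b hb, mem_leads_degreeLT]; omega
    have hle := entryStep_le hmem
    have := mem_leads_entryStep hmem
    rw [hUd _ (hle.trans hb), mem_leads_degreeLT] at this
    omega
  rw [IsLinked, standardMonomials_complement, standardMonomials_complement]
  have hmemE : ∀ (I' : Ideal (PolyRing k)), colength I' = N → ∀ a b,
      (a, b) ∈ complementExponents I' ↔ a < N ∧ b < N ∧ mon k (N - 1 - a) (N - 1 - b) ∈ I' := by
    rintro I' hI' a b
    rw [complementExponents, hI']
    rfl
  have hmemJ : ∀ a b, (a, b) ∈ complementExponents J →
      N - 1 - b ∈ leads v (U (N - 1 - a + (N - 1 - b)) (N - 1 - a + (N - 1 - b) + 1)) := by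
    intro a b hab
    rw [htop, h.mem_leads_iff]
    exact ⟨by omega, by simpa using ((hmemE J hcol.symm a b).mp hab).2.2⟩
  refine ⟨fun a b => (entryStep v (U (N - 1 - a + (N - 1 - b))) (N - 1 - b) : ℤ) -
    ((N - 1 - b : ℕ) : ℤ), ⟨fun a b h1 h2 => ?_, fun a b h1 h2 => ?_⟩, ?_⟩
  · have hb := ((hmemE J hcol.symm _ _).mp h2).2.1
    have := entryStep_succ_le (v := v) (U' := U (N - 1 - a + (N - 1 - b)))
      (fun i p hp => ?_) (hmemJ _ _ h2)
    · rw [show N - 1 - (b + 1) + 1 = N - 1 - b by omega] at this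
      beta_reduce
      omega
    · rw [show N - 1 - a + (N - 1 - b) = N - 1 - a + (N - 1 - (b + 1)) + 1 by omega]
      refine ⟨h.X_mul_mem _ _ hp.1, ?_⟩
      rw [SetLike.mem_coe, mem_degreeLT, degree_lt_iff_coeff_zero]
      intro m hm
      obtain ⟨m, rfl⟩ : ∃ n, m = n + 1 := ⟨m - 1, by omega⟩
      rw [coeff_X_mul]
      exact (degree_lt_iff_coeff_zero _ _).mp (mem_degreeLT.mp hp.2) m (by omega)
  · have ha := ((hmemE J hcol.symm _ _).mp h2).1
    have := entryStep_le_of_le (v := v) (U' := U (N - 1 - a + (N - 1 - b)))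
      (fun i => ?_) (hmemJ _ _ h2)
    · beta_reduce
      omega
    · rw [show N - 1 - a + (N - 1 - b) = N - 1 - (a + 1) + (N - 1 - b) + 1 by omega]
      exact inf_le_inf_right _ (h.le_succ _)
  · ext ⟨s, t⟩
    constructor
    · rintro ⟨⟨a, b⟩, hab, hst⟩
      obtain ⟨ha, hb, hmem⟩ := (hmemE I rfl _ _).mp hab
      obtain ⟨b', ⟨hb', hJ⟩, heq⟩ := (himage (N - 1 - a + (N - 1 - b))).symm ▸
        (show N - 1 - b ∈ {i | i ≤ N - 1 - a + (N - 1 - b) ∧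
            mon k (N - 1 - a + (N - 1 - b) - i) i ∈ I} from ⟨by omega, by simpa using hmem⟩)
      have hbox : b' < N ∧ N - 1 - a + (N - 1 - b) - b' < N := by
        by_cases hd : N ≤ N - 1 - a + (N - 1 - b)
        · rw [hlarge _ _ hd hb'] at heq
          omega
        · omega
      refine ⟨(N - 1 - (N - 1 - a + (N - 1 - b) - b'), N - 1 - b'),
        (hmemE J hcol.symm _ _).mpr ⟨by omega, by omega, ?_⟩, ?_⟩
      · rwa [show N - 1 - (N - 1 - (N - 1 - a + (N - 1 - b) - b')) =
          N - 1 - a + (N - 1 - b) - b' by omega, show N - 1 - (N - 1 - b') = b' by omega]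
      · simp only [Prod.mk.injEq] at hst ⊢
        rw [show N - 1 - (N - 1 - (N - 1 - a + (N - 1 - b) - b')) =
          N - 1 - a + (N - 1 - b) - b' by omega, show N - 1 - (N - 1 - b') = b' by omega,
          Nat.sub_add_cancel hb', heq]
        omega
    · rintro ⟨⟨a, b⟩, hab, hst⟩
      obtain ⟨ha, hb, hmem⟩ := (hmemE J hcol.symm _ _).mp hab
      have hmem' : N - 1 - b ∈ {i | i ≤ N - 1 - a + (N - 1 - b) ∧
          mon k (N - 1 - a + (N - 1 - b) - i) i ∈ J} := ⟨by omega, by simpa using hmem⟩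
      have himg := (himage (N - 1 - a + (N - 1 - b))) ▸ Set.mem_image_of_mem
        (entryStep v (U (N - 1 - a + (N - 1 - b)))) hmem'
      simp only [Prod.mk.injEq] at hst
      generalize hg : entryStep v (U (N - 1 - a + (N - 1 - b))) (N - 1 - b) = g at hst himg
      obtain ⟨hle, hmemI⟩ := himg
      have hbox : g < N ∧ N - 1 - a + (N - 1 - b) - g < N := by
        by_cases hd : N ≤ N - 1 - a + (N - 1 - b)
        · rw [hlarge _ _ hd (by omega)] at hg
          omega
        · omega
      refine ⟨(N - 1 - (N - 1 - a + (N - 1 - b) - g), N - 1 - g),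
        (hmemE I rfl _ _).mpr ⟨by omega, by omega, ?_⟩, ?_⟩
      · rwa [show N - 1 - (N - 1 - (N - 1 - a + (N - 1 - b) - g)) =
          N - 1 - a + (N - 1 - b) - g by omega, show N - 1 - (N - 1 - g) = g by omega]
      · simp only [Prod.mk.injEq]
        omega

end Degeneration

end Iarrobino

theorem mainTheorem7 {k : Type*} [Field k] [IsAlgClosed k] (H : ℕ →₀ ℕ)
    (C C' : Set (Iarrobino.Variety k H))
    (hC : Iarrobino.IsSchubertCell C) (hC' : Iarrobino.IsSchubertCell C')
    (I I' : Iarrobino.Variety k H)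
    (hI : Iarrobino.IsMonomialIdeal I.1) (hI' : Iarrobino.IsMonomialIdeal I'.1)
    (hIC : I ∈ C) (hIC' : I' ∈ C')
    (hne : (closure C ∩ C').Nonempty) :
    Iarrobino.IsLinked I.1 I'.1 ∧
      Iarrobino.IsLinked (Iarrobino.complement I.1) (Iarrobino.complement I'.1) := by
  obtain ⟨K, hKC, hKC'⟩ := hne
  obtain ⟨u, huC, hu⟩ := mem_closure_iff_ultrafilter.mp hKC
  obtain ⟨V, hV1, hV⟩ := Iarrobino.exists_valuation hu
  have hdeg : ∀ d, Iarrobino.degrees (Iarrobino.limitSlice u d) =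
      Iarrobino.degrees (Iarrobino.slice I.1 d) := fun d =>
    Iarrobino.degrees_limitSlice
      (Filter.mem_of_superset huC fun _ hJ => hC.degrees_slice_eq hJ hIC d)
  have h : Iarrobino.IsDegeneration V.valuation (Iarrobino.limitSlice u) I.1 I'.1 :=
    { le_degreeLT := Iarrobino.limitSlice_le
      le_succ := Iarrobino.limitSlice_le_succ
      X_mul_mem := fun d p hp => Iarrobino.X_mul_mem_limitSlice hp
      mem_degrees_iff := fun d j => by rw [hdeg, hI.mem_degrees_slice]
      mem_leads_iff := fun d j => by
        rw [Iarrobino.leads_limitSlice hV1 hV (hdeg d), hC'.degrees_slice_eq hKC' hIC' d,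
          hI'.mem_degrees_slice] }
  refine ⟨h.isLinked, h.isLinked_complement (I.2.2.1.trans I'.2.2.1.symm) fun a b hab => ?_⟩
  rw [I.2.2.1] at hab
  have hmem : (Polynomial.X ^ b : Polynomial k) ∈ Iarrobino.slice I.1 (a + b) := by
    rw [Iarrobino.slice_eq_of_eq_zero I (Iarrobino.apply_eq_zero_of_sum_le I hab),
      Polynomial.mem_degreeLT, Polynomial.degree_X_pow]
    exact_mod_cast (by omega : b < a + b + 1)
  simpa using (Iarrobino.mem_slice_mon (Nat.le_add_left b a)).mp hmem
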